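/- Let $K$ be a number field of degree $d=[K:\mathbb{Q}]$ with unit rank $r_K$ (the rank of $\mathcal{O}_K^\times$), group of roots of unity $\mu(K)$ and Dedekind zeta function $\zeta_K$. Let $h(\alpha)=\frac1d\sum_{v}\log\max(1,|\alpha|_v)$ denote the absolute logarithmic Weil height of $\alpha\in K$, where $v$ runs over all places of $K$ with the absolute values normalised so that the product formula holds. For $\alpha\in K^\times$ put $D(\alpha)=[\mathcal{O}_K:\alpha^{-1}\mathcal{O}_K\cap\mathcal{O}_K]$. Let $S_K\subset\mathcal{O}_K^\times$ be a finite set that is closed under inversion and contains $\mu(K)$, and let $c_S$ be a real number with $0<c_S<\inf_{u\in\mathcal{O}_K^\times\setminus S_K}h(u)$ (where $\inf\emptyset=+\infty$). Let $h_0$ be a real number with $c_S\le h_0\le 2$, and put $$t_0=\max\left\{4,\ \frac{2r_K}{d}\cdot\frac{\ln\left(1+\frac{12h_0+1}{6c_S}\right)}{\ln\left(\cosh\left(\frac{3h_0}{2}\right)\right)}\right\}.$$ Let $t>t_0$ be an integer and let $B$ be an origin-centred ball of positive radius in the Euclidean space $K_{\mathbb{R}}^t$, where $K_{\mathbb{R}}=K\otimes_{\mathbb{Q}}\mathbb{R}\cong\mathbb{R}^{r_1}\times\mathbb{C}^{r_2}$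 and $K$ acts on each of the $t$ copies of $K_{\mathbb{R}}$ by multiplication. Then the series on the left converges and $$\sum_{\alpha\in K^\times,\ h(\alpha)>h_0}D(\alpha)^{-t}\,\mathrm{vol}(B\cap\alpha^{-1}B)\ \le\ C\cdot\#S_K\cdot\frac{\zeta_K\left(\frac t4\right)^2}{\zeta_K\left(\frac t2\right)}\cdot e^{-\varepsilon d(t-t_0)}\cdot\mathrm{vol}(B),$$ where $$\varepsilon=\tfrac12\ln\left(\cosh\left(\tfrac{3h_0}{2}\right)\right)\qquad\text{and}\qquad C=1+\frac{2}{1-e^{-5d(t-t_0)/192}}.$$ -/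

import Mathlib

open scoped NumberField Pointwise

noncomputable section

namespace ModuleLattice

variable (K : Type*) [Field K] [NumberField K]

/-- The absolute logarithmic Weil height `h(α) = [K : ℚ]⁻¹ * ∑ᵥ log⁺ |α|ᵥ`, the sum running over all
places of `K` with the usual normalisation (the one for which the product formula holds). -/
def weilHeight (α : K) : ℝ := Height.logHeight₁ α / Module.finrank ℚ K

/-- The ring of integers, as an additive subgroup of `K`. -/
def ringOfIntegersAddSubgroup : AddSubgroup K := (algebraMap (𝓞 K) K).range.toAddSubgroup

/-- The denominator index `D(α) = [𝓞 K : α⁻¹ 𝓞 K ∩ 𝓞 K]`. -/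
def denomIndex (α : Kˣ) : ℕ :=
  ((α⁻¹ • ringOfIntegersAddSubgroup K) ⊓ ringOfIntegersAddSubgroup K).relIndex
    (ringOfIntegersAddSubgroup K)

open scoped Classical in
/-- The closed origin-centred ball of radius `R` in `K_ℝ ^ t`, where `K_ℝ = ℝ ^ r₁ × ℂ ^ r₂` carries
its Euclidean norm. Points are written in `Fin t → mixedSpace K`, where `K_ℝ` has its ring structure
and its Lebesgue measure; only the norm is read off in `euclidean.mixedSpace K`. -/
def ball (t : ℕ) (R : ℝ) : Set (Fin t → NumberField.mixedEmbedding.mixedSpace K) :=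
  {x | ∑ i, ‖(NumberField.mixedEmbedding.euclidean.toMixed K).symm (x i)‖ ^ 2 ≤ R ^ 2}

open scoped Classical in
variable {K} in
/-- Lebesgue measure on `K_ℝ ^ t = (ℝ ^ r₁ × ℂ ^ r₂) ^ t`. -/
def vol {t : ℕ} (A : Set (Fin t → NumberField.mixedEmbedding.mixedSpace K)) : ℝ :=
  MeasureTheory.volume.real A

variable {K} in
/-- The set `α • A` for `A ⊆ K_ℝ ^ t`: the element `α` of `K` acts on each of the `t` copies of
`K_ℝ` by multiplication, that is by `σ(α)` on the coordinate belonging to `σ : K → ℂ`. -/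
def scale {t : ℕ} (α : K) (A : Set (Fin t → NumberField.mixedEmbedding.mixedSpace K)) :
    Set (Fin t → NumberField.mixedEmbedding.mixedSpace K) :=
  (fun x i => NumberField.mixedEmbedding K α * x i) '' A

/-- The Dedekind zeta function at a real argument. (It is used for `s > 1` only, where the defining
series converges and has a real value.) -/
def realDedekindZeta (s : ℝ) : ℝ := (NumberField.dedekindZeta K (s : ℂ)).re

/-- The data `(S, c_S)`: a finite set `S` of units that is closed under inversion and contains the
roots of unity, and a positive real `c_S` strictly below the infimum of the heights of the units
outside `S` (an infimum over the empty set is `+∞`). -/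
structure IsUnitHeightBound (S : Finset (𝓞 K)ˣ) (cS : ℝ) : Prop where
  inv_mem : ∀ u ∈ S, u⁻¹ ∈ S
  torsion_subset : ∀ u ∈ NumberField.Units.torsion K, u ∈ S
  pos : 0 < cS
  lt_iInf : (cS : EReal) < ⨅ u : {u : (𝓞 K)ˣ // u ∉ S},
    ((weilHeight K (((u : (𝓞 K)ˣ) : 𝓞 K) : K) : ℝ) : EReal)

/-- The rank threshold `t₀(h₀)`. -/
def rankThreshold (cS h₀ : ℝ) : ℝ :=
  max 4 (2 * (NumberField.Units.rank K : ℝ) / (Module.finrank ℚ K : ℝ) *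
    (Real.log (1 + (12 * h₀ + 1) / (6 * cS)) / Real.log (Real.cosh (3 * h₀ / 2))))

end ModuleLattice

end

namespace ModuleLattice

/-! ### Real inequalities: log cosh, shell heights, exponential bounds. -/

section RealLemmas

open Real

/-! If x and αx lie in B, then for every a in [0,1] so does the image of x under the diagonal map
with entries √(a + (1-a)|α|_w²). Comparing determinants, the term of α is at most (D(α) · `meanNorm
a α`)^(-t) vol(B) (`vol_inter_scale_le`). Put h = h(α) and m = `logDenoms α` / d. For a = 1/2 the
product formula and Jensen's inequality for log cosh turn this bound into (e^m cosh(2h - m))^(-td/2)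
vol(B).

If cosh(3h/2) ≤ e^(m/2) cosh(2h - m) (`IsBalanced`), the term is at most (D(α)D(α⁻¹))^(-t/4)
cosh(3h/2)^(-td/2) vol(B). Elements with the same denominator ideals for α and α⁻¹ differ by units,
and packing their logarithmic vectors gives at most #S (1 + 2H/c_S)^r of them with height at most H
(`card_le_of_denIdeal_eq`). The threshold t₀ makes the decay beat this count on geometrically
growing shells (`rank_mul_log_le`, `shell_sum_le`). The two ideals are coprime, and summing over
coprime pairs gives the zeta quotient (`sum_coprime_le`).

If the balance fails, D(α)D(α⁻¹) > (19/5)^d (`lt_of_not_isBalanced`), and up to inverting α one has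
D(α)² > (19/5)^d. No units are counted here: of the t factors, four use a = 3/4 and the others
interpolate between a = 1 and a = 1/2. The α with denominator ideal b lie in the lattice b⁻¹, and
packing cross-polytopes around them compares the sum of `meanNorm (3/4) α`^(-4) with an integral,
bounding it by N(b)³, or twice that in rank 0 (`sum_inv_meanNorm_pow_le`). Summing over b is again
covered by the zeta quotient. -/

theorem cosh_add_le_exp_mul_cosh (x : ℝ) {m : ℝ} (hm : 0 ≤ m) :
    cosh (x + m) ≤ exp m * cosh x := by
  rw [cosh_eq, cosh_eq, neg_add, exp_add, exp_add]
  have h : exp (-m) ≤ exp m := exp_le_exp.2 (by linarith)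
  nlinarith [exp_pos (-x), exp_pos x]

theorem hasDerivAt_log_cosh (x : ℝ) : HasDerivAt (fun x => log (cosh x)) (tanh x) x := by
  rw [tanh_eq_sinh_div_cosh]
  exact (hasDerivAt_cosh x).log (cosh_pos x).ne'

theorem tanh_eq_one_sub (x : ℝ) : tanh x = 1 - 2 / (exp (2 * x) + 1) := by
  have h1 : exp (2 * x) = exp x * exp x := by rw [← exp_add]; ring_nf
  have h2 := exp_pos x
  rw [tanh_eq, exp_neg, h1]
  field_simp
  ring

theorem monotone_tanh : Monotone tanh := by
  intro x y hxy
  rw [tanh_eq_one_sub, tanh_eq_one_sub]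
  have : exp (2 * x) ≤ exp (2 * y) := exp_le_exp.2 (by linarith)
  gcongr

theorem convexOn_log_cosh : ConvexOn ℝ Set.univ (fun x => log (cosh x)) := by
  have hd : deriv (fun x => log (cosh x)) = tanh := funext fun x => (hasDerivAt_log_cosh x).deriv
  refine Monotone.convexOn_univ_of_deriv (fun x => (hasDerivAt_log_cosh x).differentiableAt) ?_
  rw [hd]
  exact monotone_tanh

theorem log_cosh_nonneg (x : ℝ) : 0 ≤ log (cosh x) := log_nonneg (one_le_cosh x)

theorem log_cosh_pos {x : ℝ} (hx : x ≠ 0) : 0 < log (cosh x) := log_pos (one_lt_cosh.2 hx)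

/-- Convexity between x and 0, where log cosh vanishes. -/
theorem log_cosh_mul_le {s : ℝ} (h0 : 0 ≤ s) (h1 : s ≤ 1) (x : ℝ) :
    log (cosh (s * x)) ≤ s * log (cosh x) := by
  have h := convexOn_log_cosh.2 (Set.mem_univ x) (Set.mem_univ 0) h0 (sub_nonneg.2 h1)
    (by ring)
  simpa using h

theorem le_log_cosh_mul {s : ℝ} (h1 : 1 ≤ s) (x : ℝ) :
    s * log (cosh x) ≤ log (cosh (s * x)) := by
  have hs : 0 < s := by linarith
  have h := log_cosh_mul_le (inv_nonneg.2 hs.le) (inv_le_one_of_one_le₀ h1) (s * x)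
  rw [inv_mul_cancel_left₀ hs.ne'] at h
  calc s * log (cosh x) ≤ s * (s⁻¹ * log (cosh (s * x))) := by gcongr
    _ = _ := by field_simp

theorem log_cosh_mono {x y : ℝ} (hx : 0 ≤ x) (hxy : x ≤ y) : log (cosh x) ≤ log (cosh y) := by
  apply log_le_log (cosh_pos x)
  rw [cosh_le_cosh, abs_of_nonneg hx, abs_of_nonneg (hx.trans hxy)]
  exact hxy

theorem tanh_mul_le_log_cosh_sub {x y : ℝ} (h : x ≤ y) :
    tanh x * (y - x) ≤ log (cosh y) - log (cosh x) := by
  rcases h.eq_or_lt with rfl | h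
  · simp
  have := convexOn_log_cosh.le_slope_of_hasDerivAt (Set.mem_univ x) (Set.mem_univ y) h
    (hasDerivAt_log_cosh x)
  rw [slope_def_field, le_div_iff₀ (by linarith)] at this
  exact this

/-- Jensen's inequality for `log ∘ cosh`, with integer weights. -/
theorem cosh_weighted_mean_pow_le_prod {ι : Type*} (s : Finset ι) (n : ι → ℕ) (l : ι → ℝ) (d : ℕ)
    (hd : 0 < d) (hn : ∑ i ∈ s, n i = d) :
    cosh ((∑ i ∈ s, n i * |l i|) / d) ^ d ≤ ∏ i ∈ s, cosh (l i) ^ n i := by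
  have hd' : (0 : ℝ) < d := by exact_mod_cast hd
  have hw : ∑ i ∈ s, (n i : ℝ) / d = 1 := by
    rw [← Finset.sum_div, ← Nat.cast_sum, hn, div_self hd'.ne']
  -- Since cosh is even, Jensen can be applied to the absolute values, which do not cancel in the
  -- mean.
  have h := convexOn_log_cosh.map_sum_le (t := s) (w := fun i => (n i : ℝ) / d)
    (p := fun i => |l i|) (fun i _ => by positivity) hw (fun i _ => Set.mem_univ _)
  have hp : 0 < ∏ i ∈ s, cosh (l i) ^ n i :=
    Finset.prod_pos fun i _ => pow_pos (cosh_pos _) _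
  rw [← log_le_log_iff (pow_pos (cosh_pos _) _) hp, log_pow,
    log_prod (fun i _ => (pow_pos (cosh_pos _) _).ne')]
  simp only [smul_eq_mul, cosh_abs] at h
  have e1 : ∑ i ∈ s, (n i : ℝ) / d * |l i| = (∑ i ∈ s, n i * |l i|) / d := by
    rw [Finset.sum_div]; exact Finset.sum_congr rfl fun i _ => by ring
  have e2 : ∑ i ∈ s, (n i : ℝ) / d * log (cosh (l i)) = (∑ i ∈ s, n i * log (cosh (l i))) / d := by
    rw [Finset.sum_div]; exact Finset.sum_congr rfl fun i _ => by ring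
  rw [e1, e2, le_div_iff₀ hd'] at h
  simp only [log_pow]
  linarith

/-- The maximum is at τ = 7/8, with value 7⁷/8⁸ < 1/20; weighted AM-GM on τ/7 and 1 - τ is sharp
there. -/
theorem pow_seven_mul_one_sub_le {τ : ℝ} (h0 : 0 ≤ τ) (h1 : τ ≤ 1) :
    τ ^ 7 * (1 - τ) ≤ 1 / 20 := by
  have key := Real.geom_mean_le_arith_mean2_weighted (w₁ := 7 / 8) (w₂ := 1 / 8)
    (p₁ := τ / 7) (p₂ := 1 - τ) (by norm_num) (by norm_num) (by positivity) (by linarith)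
    (by norm_num)
  have h2 : (τ / 7) ^ (7 / 8 : ℝ) * (1 - τ) ^ (1 / 8 : ℝ) ≤ 1 / 8 := by linarith
  have h3 := pow_le_pow_left₀ (mul_nonneg (rpow_nonneg (by positivity) _)
    (rpow_nonneg (by linarith) _)) h2 8
  rw [mul_pow, ← rpow_natCast, ← rpow_natCast, ← rpow_mul (by positivity),
    ← rpow_mul (by linarith)] at h3
  have e1 : (7 / 8 : ℝ) * ((8 : ℕ) : ℝ) = ((7 : ℕ) : ℝ) := by norm_num
  have e2 : (1 / 8 : ℝ) * ((8 : ℕ) : ℝ) = 1 := by norm_num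
  rw [e1, e2, rpow_natCast, rpow_one, div_pow] at h3
  have : τ ^ 7 * (1 - τ) ≤ 7 ^ 7 * (1 / 8) ^ 8 := by
    rw [div_mul_eq_mul_div, div_le_iff₀ (by norm_num)] at h3
    linarith
  exact this.trans (by norm_num)

/-- If the norms of numerator and denominator are small, then the mixed bound for `cosh` holds. -/
theorem cosh_le_exp_mul_cosh_of_exp_le {h m : ℝ} (hh : 0 ≤ h) (hm : 0 ≤ m) (hm' : exp m ≤ 19 / 5) :
    cosh (3 * h / 2) ≤ exp (m / 2) * cosh (2 * h - m) := by
  set y := exp (m / 2) with hy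
  set z := exp (h / 2) with hz
  have hy1 : 1 ≤ y := one_le_exp (by positivity)
  have hz1 : 1 ≤ z := one_le_exp (by positivity)
  have hyw : y ^ 2 ≤ 19 / 5 := by
    rw [hy, ← exp_nat_mul]; convert hm' using 2; push_cast; ring
  have e1 : exp (3 * h / 2) = z ^ 3 := by rw [hz, ← exp_nat_mul]; congr 1; push_cast; ring
  have e2 : exp (2 * h - m) = z ^ 4 / y ^ 2 := by
    rw [hz, hy, ← exp_nat_mul, ← exp_nat_mul, ← exp_sub]; congr 1; push_cast; ring
  rw [cosh_eq, cosh_eq, exp_neg, exp_neg, e1, e2]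
  have hy0 : 0 < y := by linarith
  have hz0 : 0 < z := by linarith
  suffices H : 0 ≤ z ^ 7 * (z - y) + y * (y ^ 3 - z) by
    have : y * ((z ^ 4 / y ^ 2 + (z ^ 4 / y ^ 2)⁻¹) / 2) - (z ^ 3 + (z ^ 3)⁻¹) / 2 =
        (z ^ 7 * (z - y) + y * (y ^ 3 - z)) / (2 * y * z ^ 4) := by
      field_simp; ring
    have h2 : 0 ≤ (z ^ 7 * (z - y) + y * (y ^ 3 - z)) / (2 * y * z ^ 4) := by positivity
    linarith
  rcases le_total y z with hyz | hyz
  · have h7 : y ≤ z ^ 7 := hyz.trans (le_self_pow₀ hz1 (by norm_num))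
    have h3 : y ≤ y ^ 3 := le_self_pow₀ hy1 (by norm_num)
    nlinarith [mul_nonneg (sub_nonneg.2 h7) (sub_nonneg.2 hyz)]
  · obtain ⟨τ, hτ⟩ : ∃ τ, z = y * τ := ⟨z / y, by field_simp⟩
    have hτ0 : 0 ≤ τ := by
      by_contra h'; push Not at h'; nlinarith
    have hτ1 : τ ≤ 1 := by
      by_contra h'; push Not at h'; nlinarith
    have hM := pow_seven_mul_one_sub_le hτ0 hτ1
    have hM2 : τ ^ 7 * (1 - τ) ≤ 1 - τ := by
      have : τ ^ 7 ≤ 1 := pow_le_one₀ hτ0 hτ1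
      nlinarith
    have hM0 : 0 ≤ τ ^ 7 * (1 - τ) := mul_nonneg (by positivity) (by linarith)
    set w := y ^ 2 with hw
    have hw1 : 1 ≤ w := one_le_pow₀ hy1
    set M := τ ^ 7 * (1 - τ) with hMdef
    have key : w ^ 3 * M ≤ w - τ := by
      -- Source of the constant c = 19/5: 1 + c + c² = 19.24 is below 20, so M ≤ 1/20 gives (w³ -
      -- 1)M ≤ w - 1. Adding M ≤ 1 - τ finishes.
      have hc : w ^ 3 - 1 ≤ (w - 1) * (1 + 19 / 5 + (19 / 5) ^ 2) := by
        nlinarith [mul_nonneg (sub_nonneg.2 hw1) (sub_nonneg.2 hyw)]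
      nlinarith
    have e : z ^ 7 * (z - y) + y * (y ^ 3 - z) = w * ((w - τ) - w ^ 3 * M) := by
      rw [hτ, hMdef, hw]; ring
    rw [e]
    exact mul_nonneg (by linarith) (by linarith)

theorem le_tanh {u : ℝ} (hu : 0 ≤ u) : u * (1 + u) / (1 + u + u ^ 2) ≤ tanh u := by
  rw [tanh_eq_one_sub]
  have h := quadratic_le_exp_of_nonneg (x := 2 * u) (by positivity)
  have h2 : 2 / (exp (2 * u) + 1) ≤ 2 / (2 * (1 + u + u ^ 2)) := by
    apply div_le_div_of_nonneg_left (by norm_num) (by positivity); nlinarith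
  have h3 : u * (1 + u) / (1 + u + u ^ 2) = 1 - 2 / (2 * (1 + u + u ^ 2)) := by
    field_simp; ring
  linarith

/-- The heights bounding the shells. -/
noncomputable def shellHeight (h₀ : ℝ) (k : ℕ) : ℝ := h₀ * (1 + 1 / (12 * h₀)) ^ k

theorem shellHeight_zero (h₀ : ℝ) : shellHeight h₀ 0 = h₀ := by simp [shellHeight]

/-- The ratio of the shells is chosen for this value: 2(h₀ + 1/12)/c_S is the quantity (12h₀ +
1)/(6c_S) inside the threshold t₀. -/
theorem shellHeight_one {h₀ : ℝ} (h : 0 < h₀) : shellHeight h₀ 1 = h₀ + 1 / 12 := by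
  simp only [shellHeight, pow_one]; field_simp

theorem shellHeight_pos {h₀ : ℝ} (h : 0 < h₀) (k : ℕ) : 0 < shellHeight h₀ k := by
  unfold shellHeight; positivity

theorem shellHeight_succ (h₀ : ℝ) (k : ℕ) :
    shellHeight h₀ (k + 1) = shellHeight h₀ k * (1 + 1 / (12 * h₀)) := by
  simp only [shellHeight, pow_succ, mul_assoc]

theorem monotone_shellHeight {h₀ : ℝ} (h : 0 < h₀) : Monotone (shellHeight h₀) := by
  apply monotone_nat_of_le_succ
  intro k
  rw [shellHeight_succ]
  apply le_mul_of_one_le_right (shellHeight_pos h k).le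
  have : 0 < 1 / (12 * h₀) := by positivity
  linarith

theorem tendsto_shellHeight {h₀ : ℝ} (h : 0 < h₀) :
    Filter.Tendsto (shellHeight h₀) Filter.atTop Filter.atTop := by
  have h1 : 0 < 1 / (12 * h₀) := by positivity
  exact (tendsto_pow_atTop_atTop_of_one_lt (by linarith)).const_mul_atTop h

/-- By convexity the increment is at least the slope tanh at the left end times the step. Starting
at k = 1 keeps the argument of tanh above 1/8; from k = 0 the gain would tend to 0 with h₀. -/
theorem log_cosh_shellHeight_step {h₀ : ℝ} (h : 0 < h₀) {k : ℕ} (hk : 1 ≤ k) :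
    5 / 96 ≤ log (cosh (3 * shellHeight h₀ (k + 1) / 2)) -
      log (cosh (3 * shellHeight h₀ k / 2)) := by
  have hm : shellHeight h₀ 1 ≤ shellHeight h₀ k := monotone_shellHeight h hk
  rw [shellHeight_one h] at hm
  have hs := shellHeight_succ h₀ k
  set b := shellHeight h₀ (k + 1)
  set a := shellHeight h₀ k
  have hab : b - a = a / (12 * h₀) := by rw [hs]; field_simp; ring
  have ha : 0 < a := shellHeight_pos h k
  have h1 := tanh_mul_le_log_cosh_sub (x := 3 * a / 2) (y := 3 * b / 2)
    (by have : 0 < a / (12 * h₀) := by positivity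
        linarith)
  set u := 3 * (h₀ + 1 / 12) / 2 with hu
  have hu0 : 1 / 8 < u := by rw [hu]; linarith
  have hmono : tanh u ≤ tanh (3 * a / 2) := monotone_tanh (by rw [hu]; linarith)
  have hlow := le_tanh (u := u) (by linarith)
  have hstep : (h₀ + 1 / 12) / (8 * h₀) ≤ 3 * b / 2 - 3 * a / 2 := by
    have : 3 * b / 2 - 3 * a / 2 = a / (8 * h₀) := by
      have : 3 * b / 2 - 3 * a / 2 = 3 / 2 * (b - a) := by ring
      rw [this, hab]; field_simp; ring
    rw [this]; gcongr
  refine le_trans ?_ h1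
  have hT : 0 ≤ u * (1 + u) / (1 + u + u ^ 2) := by
    have : 0 < u := by linarith
    positivity
  refine le_trans ?_ (mul_le_mul (hlow.trans hmono) hstep (by positivity)
    (hT.trans (hlow.trans hmono)))
  -- In terms of u > 1/8 it remains to see that u²(1 + u) / ((1 + u + u²)(8u - 1)) ≥ 5/96.
  have hh : h₀ = (8 * u - 1) / 12 := by rw [hu]; ring
  have e : (h₀ + 1 / 12) / (8 * h₀) = u / (8 * u - 1) := by
    rw [hh]
    have : 8 * u - 1 ≠ 0 := by linarith
    field_simp; ring
  rw [e, div_mul_div_comm, le_div_iff₀ (by have : 0 < 8 * u - 1 := by linarith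
                                           positivity)]
  nlinarith [sq_nonneg (u - 11 / 50), sq_nonneg (u - 1/4), mul_pos (sub_pos.2 hu0) (sub_pos.2 hu0),
    mul_nonneg (sub_pos.2 hu0).le (sq_nonneg (u - 11 / 50))]

theorem log_cosh_shellHeight_ge {h₀ : ℝ} (h : 0 < h₀) (k : ℕ) :
    log (cosh (3 * h₀ / 2)) + 5 / 96 * k ≤ log (cosh (3 * shellHeight h₀ (k + 1) / 2)) := by
  induction k with
  | zero =>
    simp only [Nat.cast_zero, mul_zero, add_zero]
    apply log_cosh_mono (by positivity)
    rw [zero_add, shellHeight_one h]; linarith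
  | succ k ih =>
    have := log_cosh_shellHeight_step h (k := k + 1) (by omega)
    push_cast
    linarith

/-- This and the next lemma bound the loss of the weight `psi` under a translation: the linear
exponent serves large degrees, the quadratic one small degrees. -/
theorem one_add_sq_le_exp {p : ℝ} (hp : 0 ≤ p) : (1 + p ^ 2 / 3) ^ 2 ≤ exp p := by
  have h := sum_le_exp_of_nonneg (x := p / 2) (by positivity) 5
  simp only [Finset.sum_range_succ, Finset.sum_range_zero, Nat.factorial] at h
  norm_num at h
  have h2 : 1 + p ^ 2 / 3 ≤ exp (p / 2) := by
    refine le_trans ?_ h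
    nlinarith [mul_nonneg hp (sq_nonneg (p - 4)), mul_nonneg hp (sq_nonneg (p - 3)),
      mul_nonneg hp (sq_nonneg (p - 5)), mul_nonneg hp (sq_nonneg (p*(p-4))), mul_nonneg hp hp, mul_nonneg hp (mul_nonneg hp hp)]
  calc (1 + p ^ 2 / 3) ^ 2 ≤ exp (p / 2) ^ 2 := by gcongr
    _ = exp p := by rw [← exp_nat_mul]; congr 1; push_cast; ring

theorem one_add_sq_le_exp_sq (p : ℝ) : (1 + p ^ 2 / 3) ^ 2 ≤ exp (2 / 3 * p ^ 2) := by
  have h : 1 + p ^ 2 / 3 ≤ exp (p ^ 2 / 3) := by linarith [add_one_le_exp (p ^ 2 / 3)]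
  calc (1 + p ^ 2 / 3) ^ 2 ≤ exp (p ^ 2 / 3) ^ 2 := by gcongr
    _ = _ := by rw [← exp_nat_mul]; congr 1; push_cast; ring

end RealLemmas

/-! ### Numerical bound for the cross-polytope packing. -/

section PackingConstant

open Real

theorem realIntegralConstant_le : 8 * π * √3 / 9 ≤ 121 / 25 := by
  have h1 : √3 ≤ 1.7321 := by
    rw [sqrt_le_left (by norm_num)]; norm_num
  have h2 := pi_lt_d4
  have h3 := pi_pos
  have : π * √3 ≤ 3.1416 * 1.7321 := mul_le_mul h2.le h1 (sqrt_nonneg _) (by norm_num)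
  linarith

/-- The ratio (1 + 1/d)^d ≥ 2 exceeds 1.79, so only the base case limits the constant. -/
theorem factorial_pow_le (d : ℕ) (hd : 4 ≤ d) : (179 / 100 : ℝ) ^ d * d.factorial ≤ d ^ d := by
  induction d, hd using Nat.le_induction with
  | base => norm_num [Nat.factorial]
  | succ d hd ih =>
    have hb : 2 * (d : ℝ) ^ d ≤ (d + 1 : ℝ) ^ d := by
      have h0 : (0 : ℝ) < d := by positivity
      have := one_add_mul_le_pow (a := 1 / (d : ℝ)) (by
        have : 0 < 1 / (d : ℝ) := by positivity
        linarith) d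
      have e : (d + 1 : ℝ) ^ d = (1 + 1 / (d : ℝ)) ^ d * d ^ d := by
        rw [← mul_pow]; congr 1; field_simp
      rw [e]
      have h2 : (1 : ℝ) + d * (1 / d) = 2 := by field_simp; norm_num
      rw [h2] at this
      gcongr
    rw [Nat.factorial_succ, pow_succ, pow_succ]
    push_cast
    have hd1 : (0 : ℝ) < d + 1 := by positivity
    have h3 : (179 / 100 : ℝ) ^ d * d.factorial * (179 / 100) ≤ (d + 1 : ℝ) ^ d := by
      have : (0 : ℝ) ≤ (d : ℝ) ^ d := by positivity
      nlinarith
    nlinarith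

/-- The constant arising from packing translates of a cross-polytope. -/
theorem packing_constant_le {r₁ r₂ d : ℕ} (hd : d = r₁ + 2 * r₂) (hr : 0 < r₁ + r₂) {k s : ℝ}
    (hk : 0 < k) (hk2 : 19 / 5 ≤ k ^ 2) (hs1 : s ≤ d / (2 * k)) (hs2 : s ≤ d ^ 2 / (6 * k ^ 2)) :
    exp s * ((8 * π * √3 / 9) ^ r₁ * (2048 / 81) ^ r₂) * d.factorial ≤
      (if r₁ + r₂ = 1 then 2 else 1) * (19 / 5) ^ d * d ^ d := by
  have hJ0 : 0 ≤ 8 * π * √3 / 9 := by positivity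
  have hJ := realIntegralConstant_le
  -- 5/114 is 1/(6 · 19/5). This quadratic bound is used for d < 4.
  have hs2' : s ≤ d ^ 2 * (5 / 114) := by
    refine hs2.trans ?_
    rw [div_le_iff₀ (by positivity)]
    have : (0 : ℝ) ≤ d ^ 2 := by positivity
    nlinarith
  -- 5.03 dominates both the real factor and the square root of the complex factor 2048/81.
  have hP : (8 * π * √3 / 9) ^ r₁ * (2048 / 81 : ℝ) ^ r₂ ≤ (503 / 100) ^ d := by
    rw [hd, pow_add, pow_mul]
    exact mul_le_mul (pow_le_pow_left₀ hJ0 (by linarith) _)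
      (pow_le_pow_left₀ (by norm_num) (by norm_num) _) (by positivity) (by positivity)
  have hexp : ∀ x : ℝ, 0 ≤ x → x < 1 → exp x ≤ 1 / (1 - x) := fun x h0 h1 =>
    exp_bound_div_one_sub_of_interval h0 h1
  have hP0 : 0 ≤ (8 * π * √3 / 9) ^ r₁ * (2048 / 81 : ℝ) ^ r₂ := by positivity
  have hd0 : 0 < d := by omega
  rcases lt_or_ge d 4 with h4 | h4
  · interval_cases d
    · obtain ⟨rfl, rfl⟩ : r₁ = 1 ∧ r₂ = 0 := by omega
      have h := (exp_le_exp.2 hs2').trans (hexp _ (by norm_num) (by norm_num))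
      norm_num at h ⊢
      have := mul_le_mul h hJ hJ0 (by norm_num)
      linarith
    · have h := (exp_le_exp.2 hs2').trans (hexp _ (by norm_num) (by norm_num))
      norm_num at h
      obtain ⟨rfl, rfl⟩ | ⟨rfl, rfl⟩ : (r₁ = 2 ∧ r₂ = 0) ∨ (r₁ = 0 ∧ r₂ = 1) := by omega
      · have h2 : (8 * π * √3 / 9) ^ 2 ≤ (121 / 25) ^ 2 := by gcongr
        have := mul_le_mul h h2 (by positivity) (by norm_num)
        norm_num at this ⊢
        linarith
      · norm_num
        linarith
    · have h := (exp_le_exp.2 hs2').trans (hexp _ (by norm_num) (by norm_num))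
      norm_num at h
      have h1 : r₁ + r₂ ≠ 1 := by omega
      have := mul_le_mul h hP hP0 (by norm_num)
      rw [if_neg h1]
      norm_num [Nat.factorial] at this ⊢
      linarith
  · have hk' : 1949 / 1000 ≤ k := by
      by_contra h; push Not at h
      nlinarith
    have h1 : r₁ + r₂ ≠ 1 := by omega
    rw [if_neg h1, one_mul]
    -- 500/1949 is 1/(2k) at k = 1.949, just below √(19/5).
    have hs : exp s ≤ (1 / (1 - 500 / 1949) : ℝ) ^ d := by
      have : exp s ≤ exp (500 / 1949) ^ d := by
        rw [← exp_nat_mul]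
        apply exp_le_exp.2
        refine hs1.trans ?_
        rw [div_le_iff₀ (by positivity)]
        have : (0 : ℝ) ≤ d := by positivity
        nlinarith
      refine this.trans ?_
      gcongr
      exact hexp _ (by norm_num) (by norm_num)
    calc exp s * ((8 * π * √3 / 9) ^ r₁ * (2048 / 81) ^ r₂) * d.factorial
        ≤ (1 / (1 - 500 / 1949) : ℝ) ^ d * (503 / 100) ^ d * d.factorial := by gcongr
      _ = (1 / (1 - 500 / 1949) * (503 / 100)) ^ d * d.factorial := by rw [mul_pow]
      _ ≤ (19 / 5 * (179 / 100)) ^ d * d.factorial := by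
        exact mul_le_mul_of_nonneg_right (pow_le_pow_left₀ (by norm_num) (by norm_num) _)
          (by positivity)
      _ = (19 / 5) ^ d * ((179 / 100) ^ d * d.factorial) := by rw [mul_pow]; ring
      _ ≤ _ := by gcongr; exact factorial_pow_le d h4

end PackingConstant

/-! ### Integrals of the local weights. -/

section Integrals

open Real MeasureTheory Filter Topology

theorem hasDerivAt_antiderivative (y : ℝ) :
    HasDerivAt (fun y : ℝ => 8 / 3 * (y / (3 + y ^ 2)) + 8 / (3 * √3) * arctan (y / √3))
      ((4 / (3 + y ^ 2)) ^ 2) y := by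
  have h3 : (0 : ℝ) < √3 := by positivity
  have hy : 3 + y ^ 2 ≠ 0 := by positivity
  have h1 : HasDerivAt (fun y : ℝ => y / (3 + y ^ 2))
      ((1 * (3 + y ^ 2) - y * (2 * y)) / (3 + y ^ 2) ^ 2) y := by
    apply (hasDerivAt_id y).fun_div _ hy
    simpa using ((hasDerivAt_id y).fun_pow 2).const_add 3
  have h2 : HasDerivAt (fun y : ℝ => arctan (y / √3)) (1 / (1 + (y / √3) ^ 2) * (1 / √3)) y :=
    ((hasDerivAt_id y).div_const √3).arctan
  refine ((h1.const_mul (8 / 3)).fun_add (h2.const_mul (8 / (3 * √3)))).congr_deriv ?_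
  rw [div_pow, sq_sqrt (by norm_num : (0 : ℝ) ≤ 3)]
  have e : 8 / (3 * √3) * (1 / (1 + y ^ 2 / 3) * (1 / √3)) =
      8 / (3 * (√3) ^ 2) * (1 / (1 + y ^ 2 / 3)) := by field_simp
  rw [e, sq_sqrt (by norm_num : (0 : ℝ) ≤ 3)]
  field_simp
  ring

theorem integrable_and_integral_real :
    Integrable (fun y : ℝ => (4 / (3 + y ^ 2)) ^ 2) ∧
      ∫ y : ℝ, (4 / (3 + y ^ 2)) ^ 2 = 8 * π * √3 / 9 := by
  have h3 : (0 : ℝ) < √3 := by positivity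
  have hint : Integrable (fun y : ℝ => (4 / (3 + y ^ 2)) ^ 2) := by
    refine (integrable_inv_one_add_sq.const_mul 16).mono' (by
      apply Continuous.aestronglyMeasurable
      exact (continuous_const.div (by fun_prop) fun y => by positivity).pow 2) ?_
    refine Eventually.of_forall fun y => ?_
    rw [norm_of_nonneg (by positivity), ← div_eq_mul_inv, div_pow,
      div_le_div_iff₀ (by positivity) (by positivity)]
    nlinarith [sq_nonneg y, sq_nonneg (y ^ 2)]
  refine ⟨hint, ?_⟩
  have hlim : ∀ (l : Filter ℝ) (a : ℝ), l ≤ Bornology.cobounded ℝ → Tendsto (fun y : ℝ => arctan (y / √3)) l (𝓝 a) →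
      Tendsto (fun y : ℝ => 8 / 3 * (y / (3 + y ^ 2)) + 8 / (3 * √3) * arctan (y / √3)) l
        (𝓝 (8 / 3 * 0 + 8 / (3 * √3) * a)) := by
    intro l a hl h
    refine Tendsto.add (Tendsto.const_mul _ ?_) (h.const_mul _)
    have h0 : Tendsto (fun y : ℝ => ‖y⁻¹‖) l (𝓝 0) := by
      have := (tendsto_inv₀_cobounded (α := ℝ)).mono_left hl
      simpa using this.norm
    refine squeeze_zero_norm (fun y => ?_) h0
    rcases eq_or_ne y 0 with rfl | hy
    · simp
    rw [norm_div, norm_inv, norm_of_nonneg (by positivity : 0 ≤ 3 + y ^ 2), div_le_iff₀ (by positivity)]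
    have : 0 < ‖y‖ := norm_pos_iff.2 hy
    rw [← sq_abs, ← norm_eq_abs]
    field_simp
    nlinarith
  have htop := hlim atTop (π / 2) IsOrderBornology.atTop_le_cobounded
    ((tendsto_arctan_atTop.mono_right nhdsWithin_le_nhds).comp (tendsto_id.atTop_div_const h3))
  have hbot := hlim atBot (-(π / 2)) IsOrderBornology.atBot_le_cobounded
    ((tendsto_arctan_atBot.mono_right nhdsWithin_le_nhds).comp (tendsto_id.atBot_div_const h3))
  rw [integral_of_hasDerivAt_of_tendsto hasDerivAt_antiderivative hint hbot htop]
  have : (√3) ^ 2 = 3 := sq_sqrt (by norm_num)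
  simp only [mul_zero, zero_add]
  field_simp
  nlinarith

theorem integrable_and_integral_complex :
    Integrable (fun z : ℂ => (4 / (3 + ‖z‖ ^ 2)) ^ 4) ∧
      ∫ z : ℂ, (4 / (3 + ‖z‖ ^ 2)) ^ 4 = 256 * π / 81 := by
  -- Antiderivative of the radial integrand in polar coordinates, Jacobian y included.
  have hd : ∀ y ∈ Set.Ici (0 : ℝ), HasDerivAt (fun y : ℝ => -(128 / 3) * ((3 + y ^ 2) ^ 3)⁻¹)
      (y ^ (2 - 1) • (4 / (3 + y ^ 2)) ^ 4) y := by
    intro y _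
    have hy : 3 + y ^ 2 ≠ 0 := by positivity
    have h1 : HasDerivAt (fun y : ℝ => 3 + y ^ 2) (2 * y) y := by
      simpa using ((hasDerivAt_id y).fun_pow 2).const_add 3
    refine (((h1.fun_pow 3).fun_inv (pow_ne_zero 3 hy)).const_mul (-(128 / 3))).congr_deriv ?_
    simp only [smul_eq_mul]
    field_simp
    norm_num
    ring
  have hlim : Tendsto (fun y : ℝ => -(128 / 3) * ((3 + y ^ 2) ^ 3)⁻¹) atTop
      (𝓝 (-(128 / 3) * 0)) := by
    refine Tendsto.const_mul _ (tendsto_inv_atTop_zero.comp ?_)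
    refine (tendsto_pow_atTop (by norm_num)).comp ?_
    exact tendsto_atTop_add_const_left _ _ (tendsto_pow_atTop (by norm_num))
  have hint : IntegrableOn (fun y : ℝ => y ^ (2 - 1) • (4 / (3 + y ^ 2)) ^ 4) (Set.Ioi 0) :=
    integrableOn_Ioi_deriv_of_nonneg' hd (fun y hy => by
      have : 0 < y := hy
      positivity) hlim
  constructor
  · rw [integrable_fun_norm_addHaar volume (E := ℂ) (f := fun y => (4 / (3 + y ^ 2)) ^ 4),
      Complex.finrank_real_complex]
    exact hint
  · rw [integral_fun_norm_addHaar volume (fun y => (4 / (3 + y ^ 2)) ^ 4),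
      Complex.finrank_real_complex, integral_Ioi_of_hasDerivAt_of_tendsto' hd hint hlim,
      Measure.real, Complex.volume_ball]
    simp
    ring

end Integrals

/-! ### Volume of B ∩ α⁻¹B via quadratic means. -/

section Volume

open NumberField NumberField.InfinitePlace NumberField.mixedEmbedding MeasureTheory Module
open scoped Classical

variable {K : Type*} [Field K]

/-- Multiplication by a real number at each infinite place. -/
noncomputable def placeScale (c : InfinitePlace K → ℝ) : mixedSpace K →ₗ[ℝ] mixedSpace K :=
  (LinearMap.pi fun w => (c w.1 • LinearMap.id).comp (LinearMap.proj w)).prodMap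
    (LinearMap.pi fun w => (c w.1 • LinearMap.id).comp (LinearMap.proj w))

theorem normAtPlace_placeScale (c : InfinitePlace K → ℝ) (x : mixedSpace K) (w : InfinitePlace K) :
    normAtPlace w (placeScale c x) = |c w| * normAtPlace w x := by
  rcases isReal_or_isComplex w with hw | hw
  · simp [normAtPlace_apply_of_isReal hw, placeScale]
  · simp [normAtPlace_apply_of_isComplex hw, placeScale]

theorem mean_pos {a : ℝ} (h0 : 0 ≤ a) (h1 : a ≤ 1) (α : Kˣ) (w : InfinitePlace K) :
    0 < a + (1 - a) * w (α : K) ^ 2 := by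
  have hw : 0 < w (α : K) := w.pos_iff.2 α.ne_zero
  have hw2 : 0 < w (α : K) ^ 2 := by positivity
  rcases h0.eq_or_lt with rfl | h0
  · simpa
  · have := mul_nonneg (sub_nonneg.2 h1) hw2.le
    linarith

variable [NumberField K]

theorem prod_place_eq {M : Type*} [CommMonoid M] (f : InfinitePlace K → M) :
    ∏ w, f w = (∏ w : {w : InfinitePlace K // IsReal w}, f w.1) *
      ∏ w : {w : InfinitePlace K // IsComplex w}, f w.1 := by
  rw [← Fintype.prod_subtype_mul_prod_subtype (fun w : InfinitePlace K => IsReal w)]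
  congr 1
  exact Fintype.prod_equiv (Equiv.subtypeEquivRight fun w => not_isReal_iff_isComplex) _ _
    fun _ => rfl

theorem sum_place_eq {M : Type*} [AddCommMonoid M] (f : InfinitePlace K → M) :
    ∑ w, f w = (∑ w : {w : InfinitePlace K // IsReal w}, f w.1) +
      ∑ w : {w : InfinitePlace K // IsComplex w}, f w.1 :=
  prod_place_eq (M := Multiplicative M) f

theorem det_placeScale (c : InfinitePlace K → ℝ) :
    LinearMap.det (placeScale c) = ∏ w, c w ^ mult w := by
  rw [placeScale, LinearMap.det_prodMap, LinearMap.det_pi, LinearMap.det_pi, prod_place_eq]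
  congr 1
  · refine Finset.prod_congr rfl fun w _ => ?_
    rw [LinearMap.det_smul, LinearMap.det_id, mult_isReal]
    simp
  · refine Finset.prod_congr rfl fun w _ => ?_
    rw [LinearMap.det_smul, LinearMap.det_id, mult_isComplex, Complex.finrank_real_complex, mul_one]

theorem euclidean_norm_sq (x : mixedSpace K) :
    ‖(euclidean.toMixed K).symm x‖ ^ 2 = ∑ w, normAtPlace w x ^ 2 := by
  rw [WithLp.prod_norm_sq_eq_of_L2, EuclideanSpace.norm_sq_eq, EuclideanSpace.norm_sq_eq,
    sum_place_eq]
  congr 1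
  · exact Finset.sum_congr rfl fun w _ => by rw [normAtPlace_apply_of_isReal w.2]; rfl
  · exact Finset.sum_congr rfl fun w _ => by rw [normAtPlace_apply_of_isComplex w.2]; rfl

theorem mem_ball_iff {t : ℕ} {R : ℝ} {x : Fin t → mixedSpace K} :
    x ∈ ball K t R ↔ ∑ i, ∑ w, normAtPlace w (x i) ^ 2 ≤ R ^ 2 := by
  simp only [ball, Set.mem_ofPred_eq, euclidean_norm_sq]

theorem mul_mem_ball_of_mem_scale {t : ℕ} {R : ℝ} {x : Fin t → mixedSpace K} (α : Kˣ)
    (h : x ∈ scale ((α⁻¹ : Kˣ) : K) (ball K t R)) :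
    ∑ i, ∑ w : InfinitePlace K, (w (α : K) * normAtPlace w (x i)) ^ 2 ≤ R ^ 2 := by
  obtain ⟨y, hy, rfl⟩ := h
  rw [mem_ball_iff] at hy
  convert hy using 5 with i _ w _
  simp only [map_mul, normAtPlace_apply]
  rw [← mul_assoc, ← map_mul, ← Units.val_mul]
  simp

/-- The norm of the quadratic mean of `1` and `α`, with weights `a` and `1 - a`. -/
noncomputable def meanNorm (a : ℝ) (α : K) : ℝ :=
  ∏ w : InfinitePlace K, √(a + (1 - a) * w α ^ 2) ^ mult w

theorem meanNorm_pos {a : ℝ} (h0 : 0 ≤ a) (h1 : a ≤ 1) (α : Kˣ) : 0 < meanNorm a (α : K) :=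
  Finset.prod_pos fun w _ => pow_pos (Real.sqrt_pos.2 (mean_pos h0 h1 α w)) _

instance isAddHaarMeasure_volume_pi (t : ℕ) :
    (volume : Measure (Fin t → mixedSpace K)).IsAddHaarMeasure :=
  have : MeasurableAdd (mixedSpace K) := ContinuousAdd.measurableAdd
  MeasureTheory.Measure.pi.isAddHaarMeasure _

theorem isBounded_ball (t : ℕ) (R : ℝ) : Bornology.IsBounded (ball K t R) := by
  refine (Metric.isBounded_closedBall (x := (0 : Fin t → mixedSpace K)) (r := |R|)).subset
    fun x hx => ?_
  rw [mem_ball_iff] at hx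
  rw [mem_closedBall_zero_iff, pi_norm_le_iff_of_nonneg (abs_nonneg R)]
  intro i
  have : ∀ w, normAtPlace w (x i) ≤ |R| := by
    intro w
    apply le_of_sq_le_sq _ (abs_nonneg R)
    rw [sq_abs]
    refine le_trans ?_ hx
    refine (Finset.single_le_sum (f := fun w => normAtPlace w (x i) ^ 2)
      (fun w _ => by positivity) (Finset.mem_univ w)).trans ?_
    exact Finset.single_le_sum (f := fun i => ∑ w, normAtPlace w (x i) ^ 2)
      (fun i _ => Finset.sum_nonneg fun w _ => by positivity) (Finset.mem_univ i)
  rw [norm_eq_sup'_normAtPlace]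
  exact Finset.sup'_le _ _ fun w _ => this w

theorem volume_ball_ne_top (t : ℕ) (R : ℝ) : volume (ball K t R) ≠ ⊤ :=
  (isBounded_ball t R).measure_lt_top.ne

/-- A convex combination of the inequalities |x|² ≤ R² and |αx|² ≤ R² says that a diagonal map sends
x into the ball, and the determinant of that map is `meanNorm a α ^ t`. -/
theorem vol_inter_scale_le {t : ℕ} {R a : ℝ} (h0 : 0 ≤ a) (h1 : a ≤ 1) (α : Kˣ) :
    vol (ball K t R ∩ scale ((α⁻¹ : Kˣ) : K) (ball K t R)) ≤
      (meanNorm a (α : K) ^ t)⁻¹ * vol (ball K t R) := by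
  set c : InfinitePlace K → ℝ := fun w => √(a + (1 - a) * w (α : K) ^ 2) with hc
  let f : (Fin t → mixedSpace K) →ₗ[ℝ] (Fin t → mixedSpace K) :=
    LinearMap.pi fun i => (placeScale c).comp (LinearMap.proj i)
  have hdet : LinearMap.det f = meanNorm a (α : K) ^ t := by
    rw [LinearMap.det_pi]
    simp [det_placeScale, meanNorm, hc]
  have hpos := pow_pos (meanNorm_pos h0 h1 α) t
  have hsub : ball K t R ∩ scale ((α⁻¹ : Kˣ) : K) (ball K t R) ⊆ f ⁻¹' ball K t R := by
    rintro x ⟨hx1, hx2⟩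
    have hx2 := mul_mem_ball_of_mem_scale α hx2
    rw [mem_ball_iff] at hx1
    rw [Set.mem_preimage, mem_ball_iff]
    have e : ∑ i, ∑ w, normAtPlace w (f x i) ^ 2 = a * ∑ i, ∑ w, normAtPlace w (x i) ^ 2 +
        (1 - a) * ∑ i, ∑ w, (w (α : K) * normAtPlace w (x i)) ^ 2 := by
      simp only [Finset.mul_sum, ← Finset.sum_add_distrib]
      refine Finset.sum_congr rfl fun i _ => Finset.sum_congr rfl fun w _ => ?_
      have : normAtPlace w (f x i) = |c w| * normAtPlace w (x i) := normAtPlace_placeScale c _ w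
      rw [this, mul_pow, sq_abs, hc, Real.sq_sqrt (mean_pos h0 h1 α w).le]
      ring
    rw [e]
    nlinarith [mul_le_mul_of_nonneg_left hx1 h0, mul_le_mul_of_nonneg_left hx2 (sub_nonneg.2 h1)]
  have hB : BorelSpace (Fin t → mixedSpace K) := inferInstance
  have : @BorelSpace (Fin t → mixedSpace K) UniformSpace.toTopologicalSpace _ := hB
  have hvol := Measure.addHaar_preimage_linearMap (E := Fin t → mixedSpace K) volume (f := f) (by rw [hdet]; exact hpos.ne')
    (ball K t R)
  rw [hdet, abs_of_pos (inv_pos.2 hpos)] at hvol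
  rw [vol, vol, Measure.real, Measure.real, ← ENNReal.toReal_ofReal (inv_pos.2 hpos).le,
    ← ENNReal.toReal_mul, ← hvol]
  refine ENNReal.toReal_mono ?_ (measure_mono hsub)
  rw [hvol]
  exact ENNReal.mul_ne_top ENNReal.ofReal_ne_top (volume_ball_ne_top t R)

end Volume

/-! ### Denominator ideals, product formula and height. -/

section Denominator

open NumberField NumberField.InfinitePlace Module Ideal

variable {K : Type*} [Field K]

/-- The denominator ideal of `α`. -/
def denIdeal (α : K) : Ideal (𝓞 K) where
  carrier := {x | ∃ y : 𝓞 K, α * x = y}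
  add_mem' := by
    rintro a b ⟨y, hy⟩ ⟨z, hz⟩
    simp only [RingOfIntegers.coe_eq_algebraMap] at hy hz ⊢
    exact ⟨y + z, by rw [map_add, map_add, mul_add, hy, hz]⟩
  zero_mem' := ⟨0, by simp⟩
  smul_mem' := by
    rintro c x ⟨y, hy⟩
    simp only [RingOfIntegers.coe_eq_algebraMap] at hy ⊢
    exact ⟨c * y, by rw [smul_eq_mul, map_mul, map_mul, mul_left_comm, hy]⟩

theorem mem_denIdeal {α : K} {x : 𝓞 K} : x ∈ denIdeal α ↔ ∃ y : 𝓞 K, α * x = y := Iff.rfl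

variable [NumberField K]

theorem denomIndex_eq_absNorm (α : Kˣ) : denomIndex K α = absNorm (denIdeal (α : K)) := by
  let f : 𝓞 K →+ K := (algebraMap (𝓞 K) K).toAddMonoidHom
  have h1 : (denIdeal (α : K)).toAddSubgroup =
      ((α⁻¹ • ringOfIntegersAddSubgroup K) ⊓ ringOfIntegersAddSubgroup K).comap f := by
    ext x
    simp only [Submodule.mem_toAddSubgroup, mem_denIdeal, AddSubgroup.mem_comap,
      AddSubgroup.mem_inf]
    constructor
    · rintro ⟨y, hy⟩
      refine ⟨⟨y, ⟨y, rfl⟩, ?_⟩, ⟨x, rfl⟩⟩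
      change ((α⁻¹ : Kˣ) : K) * (y : K) = (x : K)
      rw [← hy, ← mul_assoc]
      simp
    · rintro ⟨⟨_, ⟨y, rfl⟩, hy⟩, _⟩
      refine ⟨y, ?_⟩
      have hy' : ((α⁻¹ : Kˣ) : K) * (y : K) = (x : K) := hy
      rw [← hy', ← mul_assoc]
      simp
  rw [absNorm_eq_index, h1, AddSubgroup.index_comap]
  rfl

/-- Dividing (p) and (q) by their gcd (p, q) leaves coprime ideals. They are the denominators: q ∣
px becomes a divisibility in which the coprime numerator cancels. -/
theorem exists_ideal_factorization (α : Kˣ) : ∃ p q : 𝓞 K, p ≠ 0 ∧ q ≠ 0 ∧ (α : K) = p / q ∧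
    span {q} = span {p, q} * denIdeal (α : K) ∧
    span {p} = span {p, q} * denIdeal ((α⁻¹ : Kˣ) : K) ∧
    IsCoprime (denIdeal (α : K)) (denIdeal ((α⁻¹ : Kˣ) : K)) := by
  obtain ⟨p, q, hq, hα⟩ := IsFractionRing.div_surjective (A := 𝓞 K) (α : K)
  have hq0 : q ≠ 0 := nonZeroDivisors.ne_zero hq
  have hqK : (q : K) ≠ 0 := by exact_mod_cast hq0
  have hp0 : p ≠ 0 := by
    rintro rfl
    apply α.ne_zero
    rw [← hα]; simp
  have hpK : (p : K) ≠ 0 := by exact_mod_cast hp0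
  have hI : span {p, q} ≠ ⊥ := by
    intro h
    apply hp0
    have : p ∈ span {p, q} := subset_span (by simp)
    rwa [h] at this
  obtain ⟨J, hJ⟩ : span {p, q} ∣ span {q} := by
    rw [dvd_iff_le]; exact span_mono (by simp)
  obtain ⟨J', hJ'⟩ : span {p, q} ∣ span {p} := by
    rw [dvd_iff_le]; exact span_mono (by simp)
  have hcop : IsCoprime J J' := by
    rw [isCoprime_iff_sup_eq]
    have : span {p, q} * (J ⊔ J') = span {p, q} * ⊤ := by
      rw [Ideal.mul_sup, ← hJ, ← hJ', mul_top, sup_comm, ← span_insert]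
    exact mul_left_cancel₀ hI this
  have key : ∀ (β : K) (a b : 𝓞 K) (A B : Ideal (𝓞 K)), (b : K) ≠ 0 → β = a / b →
      span {b} = span {p, q} * B → span {a} = span {p, q} * A → IsCoprime B A → denIdeal β = B := by
    intro β a b A B hb hβ hB hA hc
    ext x
    have h1 : x ∈ denIdeal β ↔ b ∣ a * x := by
      rw [mem_denIdeal]
      constructor
      · rintro ⟨y, hy⟩
        refine ⟨y, ?_⟩
        apply RingOfIntegers.ext
        simp only [RingOfIntegers.coe_eq_algebraMap] at hy hb hβ ⊢
        rw [map_mul, map_mul, ← hy, hβ]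
        field_simp
      · rintro ⟨y, hy⟩
        refine ⟨y, ?_⟩
        have : (a : K) * x = b * y := by
          simp only [RingOfIntegers.coe_eq_algebraMap]
          rw [← map_mul, hy, map_mul]
        rw [hβ, div_mul_eq_mul_div, this]
        field_simp
    rw [h1, ← span_singleton_le_span_singleton, ← dvd_iff_le, ← span_singleton_mul_span_singleton,
      hB, hA, mul_assoc, mul_dvd_mul_iff_left hI, ← span_singleton_le_iff_mem, ← dvd_iff_le]
    exact ⟨fun h => hc.dvd_of_dvd_mul_left h, fun h => h.mul_left _⟩
  have e1 : denIdeal (α : K) = J := key _ p q J' J hqK hα.symm hJ hJ' hcop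
  have e2 : denIdeal ((α⁻¹ : Kˣ) : K) = J' := by
    refine key _ q p J J' hpK ?_ hJ' hJ hcop.symm
    rw [Units.val_inv_eq_inv_val, ← hα, inv_div]
  exact ⟨p, q, hp0, hq0, hα.symm, by rw [e1, ← hJ], by rw [e2, ← hJ'], by rwa [e1, e2]⟩

theorem isCoprime_denIdeal (α : Kˣ) :
    IsCoprime (denIdeal (α : K)) (denIdeal ((α⁻¹ : Kˣ) : K)) := by
  obtain ⟨p, q, -, -, -, -, -, h⟩ := exists_ideal_factorization α
  exact h

theorem denIdeal_ne_bot (α : Kˣ) : denIdeal (α : K) ≠ ⊥ := by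
  obtain ⟨p, q, hp, hq, h1, h2, h3, h4⟩ := exists_ideal_factorization α
  intro h
  rw [h, mul_bot, span_singleton_eq_bot] at h2
  exact hq h2

theorem denomIndex_pos (α : Kˣ) : 0 < denomIndex K α := by
  rw [denomIndex_eq_absNorm, Nat.pos_iff_ne_zero, Ne, absNorm_eq_zero_iff]
  exact denIdeal_ne_bot α

theorem prod_place_integer (x : 𝓞 K) :
    ∏ w : InfinitePlace K, w (x : K) ^ mult w = absNorm (span {x}) := by
  rw [prod_eq_abs_norm, absNorm_span_singleton, ← Algebra.coe_norm_int, Nat.cast_natAbs]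
  push_cast
  rfl

/-- The product formula. -/
theorem prod_place_eq_denomIndex_div (α : Kˣ) :
    ∏ w : InfinitePlace K, w (α : K) ^ mult w = denomIndex K α⁻¹ / denomIndex K α := by
  obtain ⟨p, q, hp, hq, h1, h2, h3, h4⟩ := exists_ideal_factorization α
  have hI : (absNorm (span {p, q}) : ℝ) ≠ 0 := by
    intro h
    rw [Nat.cast_eq_zero, absNorm_eq_zero_iff] at h
    rw [h, bot_mul, span_singleton_eq_bot] at h2
    exact hq h2
  simp only [h1, map_div₀, div_pow, Finset.prod_div_distrib]
  rw [prod_place_integer, prod_place_integer, h2, h3, map_mul, map_mul, Nat.cast_mul, Nat.cast_mul,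
    mul_div_mul_left _ _ hI, denomIndex_eq_absNorm, denomIndex_eq_absNorm]

/-- For α = p/q the finite places contribute N((p, q))⁻¹; clearing |q|_w at the infinite places
contributes N((q)), and the quotient is D(α). -/
theorem mulHeight₁_eq_prod_mul_denomIndex (α : Kˣ) : Height.mulHeight₁ (α : K) =
    (∏ w : InfinitePlace K, max (w (α : K)) 1 ^ mult w) * denomIndex K α := by
  obtain ⟨p, q, hp, hq, h1, h2, h3, h4⟩ := exists_ideal_factorization α
  have hqK : (q : K) ≠ 0 := by exact_mod_cast hq
  have hI : (absNorm (span {p, q}) : ℝ) ≠ 0 := by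
    intro h
    rw [Nat.cast_eq_zero, absNorm_eq_zero_iff] at h
    rw [h, bot_mul, span_singleton_eq_bot] at h2
    exact hq h2
  have hfin := NumberField.absNorm_mul_finprod_finitePlace_eq_one (x := ![p, q])
    (fun h => hp (congrFun h 0))
  have hr : Set.range ![p, q] = {p, q} := by simp [Matrix.range_cons, Set.pair_comm]
  have hv : (fun i => ((![p, q] i : 𝓞 K) : K)) = ![(p : K), q] := by
    ext i; fin_cases i <;> rfl
  rw [hr] at hfin
  have hsup : ∀ w : InfinitePlace K, (⨆ i, w (![(p : K), q] i)) =
      max (w (α : K)) 1 * w (q : K) := by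
    intro w
    have hwq : 0 < w (q : K) := w.pos_iff.2 hqK
    rw [h1, map_div₀, max_mul_of_nonneg _ _ hwq.le, div_mul_cancel₀ _ hwq.ne', one_mul]
    apply le_antisymm
    · refine ciSup_le fun i => ?_
      fin_cases i
      · exact le_max_left _ _
      · exact le_max_right _ _
    · exact max_le (le_ciSup (f := fun i => w (![(p : K), q] i)) (Set.finite_range _).bddAbove 0)
        (le_ciSup (f := fun i => w (![(p : K), q] i)) (Set.finite_range _).bddAbove 1)
  have hfin' : ∏ᶠ v : FinitePlace K, ⨆ i, v (![(p : K), q] i) = (absNorm (span {p, q}) : ℝ)⁻¹ := by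
    rw [← hv]
    exact eq_inv_of_mul_eq_one_right hfin
  have hne : ![(p : K), q] ≠ 0 := fun h => hqK (congrFun h 1)
  conv_lhs => rw [h1]
  rw [Height.mulHeight₁_div_eq_mulHeight, NumberField.mulHeight_eq hne, hfin']
  simp only [hsup, mul_pow, Finset.prod_mul_distrib]
  rw [prod_place_integer, h2, map_mul, Nat.cast_mul, denomIndex_eq_absNorm]
  field_simp

theorem finrank_mul_weilHeight (α : K) :
    (finrank ℚ K : ℝ) * weilHeight K α = Height.logHeight₁ α := by
  have : (finrank ℚ K : ℝ) ≠ 0 := by exact_mod_cast finrank_pos.ne'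
  rw [weilHeight]; field_simp

theorem weilHeight_nonneg (α : K) : 0 ≤ weilHeight K α :=
  div_nonneg (Height.zero_le_logHeight₁ α) (by positivity)

theorem weilHeight_inv (α : Kˣ) : weilHeight K ((α⁻¹ : Kˣ) : K) = weilHeight K (α : K) := by
  rw [weilHeight, weilHeight, Units.val_inv_eq_inv_val, Height.logHeight₁_inv]

theorem sum_log_place (α : Kˣ) : ∑ w : InfinitePlace K, (mult w : ℝ) * Real.log (w (α : K)) =
    Real.log (denomIndex K α⁻¹) - Real.log (denomIndex K α) := by
  rw [← Real.log_div (by exact_mod_cast (denomIndex_pos _).ne')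
    (by exact_mod_cast (denomIndex_pos _).ne'), ← prod_place_eq_denomIndex_div,
    Real.log_prod fun w _ => pow_ne_zero _ (w.pos_iff.2 α.ne_zero).ne']
  simp

/-- From |x| = 2 max(x, 0) - x: the first part is governed by the height, the second by the product
formula. -/
theorem sum_abs_log_place (α : Kˣ) :
    ∑ w : InfinitePlace K, (mult w : ℝ) * |Real.log (w (α : K))| =
      2 * (finrank ℚ K * weilHeight K (α : K)) -
        (Real.log (denomIndex K α) + Real.log (denomIndex K α⁻¹)) := by
  have h1 : (finrank ℚ K : ℝ) * weilHeight K (α : K) =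
      (∑ w : InfinitePlace K, (mult w : ℝ) * max (Real.log (w (α : K))) 0) +
        Real.log (denomIndex K α) := by
    rw [finrank_mul_weilHeight, Height.logHeight₁_eq_log_mulHeight₁,
      mulHeight₁_eq_prod_mul_denomIndex, Real.log_mul
      (Finset.prod_pos fun w _ => by positivity).ne' (by exact_mod_cast (denomIndex_pos _).ne'),
      Real.log_prod fun w _ => by positivity]
    congr 1
    refine Finset.sum_congr rfl fun w _ => ?_
    have hw : 0 < w (α : K) := w.pos_iff.2 α.ne_zero
    rw [Real.log_pow]
    congr 1
    rcases le_total (w (α : K)) 1 with h | h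
    · rw [max_eq_right h, Real.log_one, max_eq_right (Real.log_nonpos hw.le h)]
    · rw [max_eq_left h, max_eq_left (Real.log_nonneg h)]
  have h2 := sum_log_place α
  have h3 : ∑ w : InfinitePlace K, (mult w : ℝ) * |Real.log (w (α : K))| =
      2 * ∑ w : InfinitePlace K, (mult w : ℝ) * max (Real.log (w (α : K))) 0 -
        ∑ w : InfinitePlace K, (mult w : ℝ) * Real.log (w (α : K)) := by
    rw [Finset.mul_sum, ← Finset.sum_sub_distrib]
    refine Finset.sum_congr rfl fun w _ => ?_
    rcases le_total (Real.log (w (α : K))) 0 with h | h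
    · rw [max_eq_right h, abs_of_nonpos h]; ring
    · rw [max_eq_left h, abs_of_nonneg h]; ring
  linarith

end Denominator

/-! ### Packing balls of bounded multiplicity. -/

section Packing

open MeasureTheory Module

/-- A packing bound for balls with bounded overlap. -/
theorem card_le_mul_pow_of_card_near_le {E ι : Type*} [NormedAddCommGroup E] [NormedSpace ℝ E]
    [FiniteDimensional ℝ E] (T : Finset ι) (y : ι → E) (N : ℕ) {ρ R : ℝ} (hρ : 0 < ρ) (hR : 0 ≤ R)
    (hy : ∀ i ∈ T, ‖y i‖ ≤ R)
    (hN : ∀ i ∈ T, ∀ T' ⊆ T, (∀ j ∈ T', dist (y i) (y j) < 2 * ρ) → T'.card ≤ N) :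
    (T.card : ℝ) ≤ N * (1 + R / ρ) ^ finrank ℝ E := by
  classical
  borelize E
  let μ : Measure E := Measure.addHaar
  -- If some ball contains z, all centres of balls containing z are within 2ρ of its centre, so at
  -- most N balls meet there. Integrating compares volumes.
  have hpt : ∀ z : E, ∑ i ∈ T, (Metric.ball (y i) ρ).indicator (1 : E → ENNReal) z ≤
      (Metric.ball (0 : E) (R + ρ)).indicator (fun _ => (N : ENNReal)) z := by
    intro z
    have h1 : ∑ i ∈ T, (Metric.ball (y i) ρ).indicator (1 : E → ENNReal) z =
        ((T.filter fun i => z ∈ Metric.ball (y i) ρ).card : ENNReal) := by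
      rw [Finset.card_filter]
      push_cast
      exact Finset.sum_congr rfl fun i _ => by simp [Set.indicator_apply]
    rw [h1]
    rcases (T.filter fun i => z ∈ Metric.ball (y i) ρ).eq_empty_or_nonempty with h | ⟨i, hi⟩
    · rw [h]; simp
    · rw [Finset.mem_filter, Metric.mem_ball] at hi
      have hz : z ∈ Metric.ball (0 : E) (R + ρ) := by
        rw [Metric.mem_ball]
        calc dist z 0 ≤ dist z (y i) + dist (y i) 0 := dist_triangle _ _ _
          _ < R + ρ := by rw [dist_zero_right]; linarith [hy i hi.1]
      rw [Set.indicator_of_mem hz]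
      norm_cast
      refine hN i hi.1 _ (Finset.filter_subset _ _) fun j hj => ?_
      rw [Finset.mem_filter, Metric.mem_ball] at hj
      calc dist (y i) (y j) ≤ dist (y i) z + dist z (y j) := dist_triangle _ _ _
        _ < 2 * ρ := by rw [dist_comm (y i) z]; linarith
  have hint := lintegral_mono (μ := μ) hpt
  rw [lintegral_finsetSum _ fun i _ => measurable_one.indicator measurableSet_ball,
    lintegral_indicator_const measurableSet_ball] at hint
  simp only [lintegral_indicator_one measurableSet_ball] at hint
  have hb : ∀ x : E, ∀ s : ℝ, 0 < s → μ (Metric.ball x s) =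
      ENNReal.ofReal (s ^ finrank ℝ E) * μ (Metric.ball 0 1) := fun x s hs =>
    Measure.addHaar_ball_of_pos μ x hs
  simp only [hb _ _ hρ, hb _ _ (by linarith : 0 < R + ρ), Finset.sum_const, nsmul_eq_mul,
    ← mul_assoc] at hint
  rw [ENNReal.mul_le_mul_iff_left (Metric.measure_ball_pos μ _ one_pos).ne' measure_ball_lt_top.ne] at hint
  rw [← ENNReal.ofReal_natCast, ← ENNReal.ofReal_natCast, ← ENNReal.ofReal_mul (by positivity),
    ← ENNReal.ofReal_mul (by positivity), ENNReal.ofReal_le_ofReal_iff (by positivity)] at hint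
  have e : 1 + R / ρ = (R + ρ) / ρ := by field_simp; ring
  rw [e, div_pow, ← mul_div_assoc, le_div_iff₀ (by positivity)]
  exact hint

end Packing

/-! ### Counting elements with fixed denominators by the logarithmic embedding. -/

section UnitCount

open NumberField NumberField.InfinitePlace Module Ideal

variable {K : Type*} [Field K]

theorem denIdeal_integer (x : 𝓞 K) : denIdeal (x : K) = ⊤ := by
  rw [eq_top_iff_one]
  exact ⟨x, by simp⟩

variable [NumberField K]

theorem exists_unit_of_denIdeal_eq {α β : Kˣ} (h1 : denIdeal (α : K) = denIdeal (β : K))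
    (h2 : denIdeal ((α⁻¹ : Kˣ) : K) = denIdeal ((β⁻¹ : Kˣ) : K)) :
    ∃ u : (𝓞 K)ˣ, (α : K) = ((u : 𝓞 K) : K) * β := by
  obtain ⟨p, q, hp, hq, e1, e2, e3, -⟩ := exists_ideal_factorization α
  obtain ⟨p', q', hp', hq', e1', e2', e3', -⟩ := exists_ideal_factorization β
  have h : span {p' * q} = span {p * q'} := by
    rw [← span_singleton_mul_span_singleton, ← span_singleton_mul_span_singleton, e2, e3, e2', e3',
      h1, h2]
    ring
  rw [span_singleton_eq_span_singleton] at h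
  obtain ⟨u, hu⟩ := h
  refine ⟨u, ?_⟩
  have hqK : (q : K) ≠ 0 := by exact_mod_cast hq
  have hqK' : (q' : K) ≠ 0 := by exact_mod_cast hq'
  have := congrArg (algebraMap (𝓞 K) K) hu
  simp only [map_mul] at this
  simp only [RingOfIntegers.coe_eq_algebraMap] at *
  rw [e1, e1', mul_div_assoc', div_eq_div_iff hqK hqK', ← this]
  ring

theorem lt_weilHeight_of_notMem {S : Finset (𝓞 K)ˣ} {cS : ℝ} (hS : IsUnitHeightBound K S cS)
    {u : (𝓞 K)ˣ} (hu : u ∉ S) : cS < weilHeight K (((u : 𝓞 K)) : K) := by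
  have := hS.lt_iInf.trans_le (iInf_le _ ⟨u, hu⟩)
  exact_mod_cast this

theorem sum_abs_log_place_unit (u : (𝓞 K)ˣ) :
    ∑ w : InfinitePlace K, (mult w : ℝ) * |Real.log (w ((u : 𝓞 K) : K))| =
      2 * (finrank ℚ K * weilHeight K ((u : 𝓞 K) : K)) := by
  let α : Kˣ := Units.map (algebraMap (𝓞 K) K).toMonoidHom u
  have h1 : denomIndex K α = 1 := by
    rw [denomIndex_eq_absNorm, show (α : K) = ((u : 𝓞 K) : K) from rfl, denIdeal_integer]
    simp
  have h2 : denomIndex K α⁻¹ = 1 := by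
    rw [denomIndex_eq_absNorm, show ((α⁻¹ : Kˣ) : K) = (((u⁻¹ : (𝓞 K)ˣ) : 𝓞 K) : K) from rfl,
      denIdeal_integer]
    simp
  have := sum_abs_log_place α
  rw [h1, h2, Nat.cast_one, Real.log_one, add_zero, sub_zero] at this
  exact this

variable (K) in
/-- The trace zero hyperplane, with the norm `∑ |x v|`. -/
noncomputable abbrev traceZero : Submodule ℝ (PiLp 1 fun _ : InfinitePlace K => ℝ) :=
  LinearMap.ker (∑ w : InfinitePlace K, PiLp.projₗ (𝕜 := ℝ) 1 (fun _ : InfinitePlace K => ℝ) w)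

theorem mem_traceZero {x : PiLp 1 fun _ : InfinitePlace K => ℝ} :
    x ∈ traceZero K ↔ ∑ w, x w = 0 := by
  rw [LinearMap.mem_ker, LinearMap.sum_apply]
  rfl

theorem finrank_traceZero : finrank ℝ (traceZero K) = Units.rank K := by
  have h : (∑ w : InfinitePlace K, PiLp.projₗ (𝕜 := ℝ) 1 (fun _ : InfinitePlace K => ℝ) w) ≠ 0 := by
    intro h
    have := LinearMap.congr_fun h (WithLp.toLp 1 fun _ => 1)
    simp [LinearMap.sum_apply] at this
  have h1 : finrank ℝ (traceZero K) + 1 = finrank ℝ (PiLp 1 fun _ : InfinitePlace K => ℝ) :=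
    Module.Dual.finrank_ker_add_one_of_ne_zero h
  have h2 : finrank ℝ (PiLp 1 fun _ : InfinitePlace K => ℝ) = Fintype.card (InfinitePlace K) := by
    rw [(WithLp.linearEquiv 1 ℝ _).finrank_eq, finrank_fintype_fun_eq_card]
  rw [Units.rank]
  omega

/-- The logarithmic embedding, projected to the trace zero hyperplane. -/
noncomputable def logProj (α : Kˣ) : traceZero K :=
  ⟨WithLp.toLp 1 fun w => mult w * Real.log (w (α : K)) - mult w *
    ((∑ v : InfinitePlace K, mult v * Real.log (v (α : K))) / finrank ℚ K), by
    rw [mem_traceZero]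
    have h : (∑ w : InfinitePlace K, (mult w : ℝ)) = finrank ℚ K := by
      exact_mod_cast sum_mult_eq (K := K)
    have h0 : (finrank ℚ K : ℝ) ≠ 0 := by exact_mod_cast finrank_pos.ne'
    simp only
    rw [Finset.sum_sub_distrib, ← Finset.sum_mul, h]
    field_simp
    ring⟩

theorem norm_traceZero (x : traceZero K) : ‖x‖ = ∑ w, |x.1 w| := by
  rw [Submodule.coe_norm, PiLp.norm_eq_of_L1]
  rfl

/-- Projecting adds at most |A - B| to the ℓ¹ norm, with A, B the logarithms of D(α), D(α⁻¹). The
unprojected norm is already smaller than the bound by A + B, which absorbs this. -/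
theorem norm_logProj_le (α : Kˣ) : ‖logProj α‖ ≤ 2 * (finrank ℚ K * weilHeight K (α : K)) := by
  have h : (∑ w : InfinitePlace K, (mult w : ℝ)) = finrank ℚ K := by
    exact_mod_cast sum_mult_eq (K := K)
  have h0 : (0 : ℝ) < finrank ℚ K := by exact_mod_cast finrank_pos
  rw [norm_traceZero]
  have h1 : ∑ w, |(logProj α).1 w| ≤ ∑ w : InfinitePlace K,
      (mult w * |Real.log (w (α : K))| + mult w *
        (|∑ v : InfinitePlace K, mult v * Real.log (v (α : K))| / finrank ℚ K)) := by
    refine Finset.sum_le_sum fun w _ => (abs_sub _ _).trans ?_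
    simp [abs_mul, abs_div]
  refine h1.trans ?_
  have hA : 0 ≤ Real.log (denomIndex K α) := Real.log_natCast_nonneg _
  have hB : 0 ≤ Real.log (denomIndex K α⁻¹) := Real.log_natCast_nonneg _
  rw [Finset.sum_add_distrib, ← Finset.sum_mul, h, mul_div_cancel₀ _ h0.ne', sum_abs_log_place,
    sum_log_place]
  rcases abs_cases (Real.log (denomIndex K α⁻¹) - Real.log (denomIndex K α)) with h | h <;> linarith

theorem dist_logProj {α β : Kˣ} {u : (𝓞 K)ˣ} (h : (α : K) = ((u : 𝓞 K) : K) * β) :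
    dist (logProj α) (logProj β) = 2 * (finrank ℚ K * weilHeight K ((u : 𝓞 K) : K)) := by
  have hl : ∀ w : InfinitePlace K, Real.log (w (α : K)) =
      Real.log (w ((u : 𝓞 K) : K)) + Real.log (w (β : K)) := by
    intro w
    have hu : ((u : 𝓞 K) : K) ≠ 0 := by
      intro h0
      rw [h0, zero_mul] at h
      exact α.ne_zero h
    rw [h, map_mul, Real.log_mul (w.pos_iff.2 hu).ne' (w.pos_iff.2 β.ne_zero).ne']
  have hs : ∑ v : InfinitePlace K, (mult v : ℝ) * Real.log (v ((u : 𝓞 K) : K)) = 0 :=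
    Units.sum_mult_mul_log u
  rw [dist_eq_norm, norm_traceZero, ← sum_abs_log_place_unit]
  refine Finset.sum_congr rfl fun w _ => ?_
  have e : (logProj α - logProj β).1 w =
      mult w * Real.log (w ((u : 𝓞 K) : K)) := by
    change (mult w * Real.log (w (α : K)) - mult w *
      ((∑ v : InfinitePlace K, mult v * Real.log (v (α : K))) / finrank ℚ K)) -
      (mult w * Real.log (w (β : K)) - mult w *
      ((∑ v : InfinitePlace K, mult v * Real.log (v (β : K))) / finrank ℚ K)) = _
    simp only [hl, mul_add, Finset.sum_add_distrib, hs]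
    ring
  rw [e, abs_mul, Nat.abs_cast]

/-- Two such elements differ by a unit u, and their logarithmic vectors are at distance 2d·h(u).
Distance below 2d·c_S forces u ∈ S, so balls of radius d·c_S overlap at most #S times in a space of
dimension r. -/
theorem card_le_of_denIdeal_eq {S : Finset (𝓞 K)ˣ} {cS : ℝ} (hS : IsUnitHeightBound K S cS)
    {H : ℝ} (hH : 0 ≤ H) (T : Finset Kˣ) (hT : ∀ α ∈ T, weilHeight K (α : K) ≤ H)
    (hden : ∀ α ∈ T, ∀ β ∈ T, denIdeal (α : K) = denIdeal (β : K) ∧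
      denIdeal ((α⁻¹ : Kˣ) : K) = denIdeal ((β⁻¹ : Kˣ) : K)) :
    (T.card : ℝ) ≤ S.card * (1 + 2 * H / cS) ^ Units.rank K := by
  classical
  have hc := hS.pos
  have h0 : (0 : ℝ) < finrank ℚ K := by exact_mod_cast finrank_pos
  have := card_le_mul_pow_of_card_near_le T (logProj (K := K)) S.card
    (ρ := finrank ℚ K * cS) (R := 2 * (finrank ℚ K * H)) (by positivity) (by positivity)
    (fun α hα => (norm_logProj_le α).trans (by gcongr; exact hT α hα)) (by
      intro α hα T' hT' hdist
      choose! u hu using fun β (hβ : β ∈ T') =>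
        exists_unit_of_denIdeal_eq (hden α hα β (hT' hβ)).1 (hden α hα β (hT' hβ)).2
      refine Finset.card_le_card_of_injOn u (fun β hβ => ?_) fun β hβ γ hγ h => ?_
      · by_contra hn
        have h1 := lt_weilHeight_of_notMem hS hn
        have h2 := hdist β hβ
        rw [dist_logProj (hu β hβ), mul_lt_mul_iff_right₀ two_pos,
          mul_lt_mul_iff_right₀ h0] at h2
        linarith
      · have h1 := hu β hβ
        rw [hu γ hγ, h] at h1
        have hne : (((u γ : (𝓞 K)ˣ) : 𝓞 K) : K) ≠ 0 := by
          intro h0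
          have := hu γ hγ
          rw [h0, zero_mul] at this
          exact α.ne_zero this
        exact (Units.ext (mul_left_cancel₀ hne h1)).symm)
  rw [finrank_traceZero] at this
  convert this using 4
  field_simp

end UnitCount

/-! ### The zeta function as a sum over ideals, and coprime pairs. -/

section Zeta

open NumberField Ideal Filter Topology Asymptotics

variable (K : Type*) [Field K] [NumberField K]

theorem summable_card_absNorm {s : ℝ} (hs : 1 < s) :
    LSeriesSummable (fun n => ((Nat.card {I : Ideal (𝓞 K) // absNorm I = n} : ℝ) : ℂ)) (s : ℂ) := by
  refine LSeriesSummable_of_sum_norm_bigO_and_nonneg (r := 1) ?_ (fun _ => Nat.cast_nonneg _)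
    zero_le_one (by simpa using hs)
  refine isBigO_atTop_natCast_rpow_of_tendsto_div_rpow (𝕜 := ℝ)
    (a := NumberField.dedekindZeta_residue K) ?_
  simp only [Real.rpow_one]
  refine ((Ideal.tendsto_norm_le_div_atTop₀ K).comp tendsto_natCast_atTop_atTop).congr fun n => ?_
  simp only [Function.comp_apply, Nat.cast_le, ← Nat.cast_sum]
  congr
  rw [← add_left_inj 1, ← card_norm_le_eq_card_norm_le_add_one,
    show Finset.Icc 1 n = Finset.Ioc 0 n from Finset.Icc_succ_left_eq_Ioc _ _,
    show 1 = Nat.card {I : Ideal (𝓞 K) // absNorm I = 0} by simp [Ideal.absNorm_eq_zero_iff],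
    Finset.sum_Ioc_add_eq_sum_Icc (n.zero_le),
    ← Finset.card_preimage_eq_sum_card_image_eq (fun k _ => finite_setOfPred_absNorm_eq k)]
  simp [Set.coe_eq_subtype]

/-- The zero ideal may stay in the sum: 0 to a nonzero real power is 0 by convention. -/
theorem hasSum_realDedekindZeta {s : ℝ} (hs : 1 < s) :
    HasSum (fun I : Ideal (𝓞 K) => (absNorm I : ℝ) ^ (-s)) (realDedekindZeta K s) := by
  have hs0 : -s ≠ 0 := by linarith
  have h1 : HasSum (fun n : ℕ => (Nat.card {I : Ideal (𝓞 K) // absNorm I = n} : ℝ) *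
      (n : ℝ) ^ (-s)) (realDedekindZeta K s) := by
    have h := (summable_card_absNorm K hs).hasSum
    have h2 := Complex.hasSum_re h
    convert h2 using 1
    swap
    · simp only [realDedekindZeta, NumberField.dedekindZeta, LSeries, Complex.ofReal_natCast]
    funext n
    rcases eq_or_ne n 0 with rfl | hn
    · simp [Real.zero_rpow hs0]
    · rw [LSeries.term_of_ne_zero hn, Real.rpow_neg (Nat.cast_nonneg n), ← div_eq_mul_inv,
        ← Complex.ofReal_natCast, ← Complex.ofReal_cpow (Nat.cast_nonneg n), ← Complex.ofReal_div,
        Complex.ofReal_re]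
  rw [← (Equiv.sigmaFiberEquiv (absNorm : Ideal (𝓞 K) → ℕ)).hasSum_iff]
  have hfin : ∀ n, Finite {I : Ideal (𝓞 K) // absNorm I = n} := fun n =>
    (finite_setOfPred_absNorm_eq n).to_subtype
  have hf : ∀ n : ℕ, HasSum (fun I : {I : Ideal (𝓞 K) // absNorm I = n} =>
      (absNorm (I : Ideal (𝓞 K)) : ℝ) ^ (-s))
      ((Nat.card {I : Ideal (𝓞 K) // absNorm I = n} : ℝ) * (n : ℝ) ^ (-s)) := by
    intro n
    have := Fintype.ofFinite {I : Ideal (𝓞 K) // absNorm I = n}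
    convert hasSum_fintype _ using 1
    rw [Finset.sum_congr rfl fun I _ => by rw [I.2], Finset.sum_const, Nat.card_eq_fintype_card,
      nsmul_eq_mul, Finset.card_univ]
  have hsum : Summable ((fun I : Ideal (𝓞 K) => (absNorm I : ℝ) ^ (-s)) ∘
      Equiv.sigmaFiberEquiv (absNorm : Ideal (𝓞 K) → ℕ)) := by
    rw [summable_sigma_of_nonneg fun x => by simp only [Function.comp]; positivity]
    refine ⟨fun n => (hf n).summable, ?_⟩
    convert h1.summable using 2 with n
    exact (hf n).tsum_eq
  have h3 := hsum.hasSum.sigma hf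
  rw [← h3.unique h1]
  exact hsum.hasSum

theorem realDedekindZeta_pos {s : ℝ} (hs : 1 < s) : 0 < realDedekindZeta K s := by
  have h := hasSum_realDedekindZeta K hs
  refine lt_of_lt_of_le one_pos ?_
  have := le_hasSum h (⊤ : Ideal (𝓞 K)) fun I _ => by positivity
  simpa using this

/-- Multiplying by ζ(2s) inserts a common factor g: the map (g, a, b) ↦ (ga, gb) is injective for g
≠ 0, since coprimality recovers g as the gcd. The products are thus among the terms of ζ(s)². -/
theorem sum_coprime_le {s : ℝ} (hs : 1 < s) (P : Finset (Ideal (𝓞 K) × Ideal (𝓞 K)))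
    (hP : ∀ p ∈ P, IsCoprime p.1 p.2 ∧ p.1 ≠ ⊥ ∧ p.2 ≠ ⊥) :
    ∑ p ∈ P, ((absNorm p.1 : ℝ) * absNorm p.2) ^ (-s) ≤
      realDedekindZeta K s ^ 2 / realDedekindZeta K (2 * s) := by
  classical
  have h1 := hasSum_realDedekindZeta K hs
  have h2 := hasSum_realDedekindZeta K (s := 2 * s) (by linarith)
  have hprod : HasSum (fun x : Ideal (𝓞 K) × Ideal (𝓞 K) =>
      (absNorm x.1 : ℝ) ^ (-s) * (absNorm x.2 : ℝ) ^ (-s)) (realDedekindZeta K s ^ 2) := by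
    rw [pow_two]
    exact h1.mul h1 (h1.summable.mul_of_nonneg h1.summable (fun _ => by positivity)
      fun _ => by positivity)
  rw [le_div_iff₀ (realDedekindZeta_pos K (by linarith)), mul_comm]
  refine le_of_tendsto (h2.mul_right _) (Eventually.of_forall fun G => ?_)
  have hG : ∑ g ∈ G, (absNorm g : ℝ) ^ (-(2 * s)) * ∑ p ∈ P, ((absNorm p.1 : ℝ) * absNorm p.2) ^ (-s)
      = ∑ g ∈ G.erase ⊥, (absNorm g : ℝ) ^ (-(2 * s)) *
        ∑ p ∈ P, ((absNorm p.1 : ℝ) * absNorm p.2) ^ (-s) := by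
    by_cases h : ⊥ ∈ G
    · rw [← Finset.add_sum_erase _ _ h, absNorm_bot, Nat.cast_zero,
        Real.zero_rpow (by linarith), zero_mul, zero_add]
    · rw [Finset.erase_eq_of_notMem h]
  rw [hG]
  simp only [Finset.mul_sum]
  rw [← Finset.sum_product']
  let Φ : Ideal (𝓞 K) × (Ideal (𝓞 K) × Ideal (𝓞 K)) → Ideal (𝓞 K) × Ideal (𝓞 K) :=
    fun x => (x.1 * x.2.1, x.1 * x.2.2)
  have hinj : Set.InjOn Φ ↑((G.erase ⊥) ×ˢ P) := by
    rintro ⟨g, a, b⟩ hx ⟨g', a', b'⟩ hx' h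
    simp only [Finset.coe_product, Set.mem_prod, Finset.mem_coe, Finset.mem_erase] at hx hx'
    simp only [Φ, Prod.mk.injEq] at h
    have hg : g = g' := by
      have e1 : g * a ⊔ g * b = g := by
        rw [← Ideal.mul_sup, isCoprime_iff_sup_eq.1 (hP _ hx.2).1, mul_top]
      have e2 : g' * a' ⊔ g' * b' = g' := by
        rw [← Ideal.mul_sup, isCoprime_iff_sup_eq.1 (hP _ hx'.2).1, mul_top]
      rw [← e1, ← e2, h.1, h.2]
    subst hg
    rw [mul_left_cancel₀ hx.1.1 h.1, mul_left_cancel₀ hx.1.1 h.2]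
  calc _ = ∑ x ∈ (G.erase ⊥) ×ˢ P, (absNorm (Φ x).1 : ℝ) ^ (-s) * (absNorm (Φ x).2 : ℝ) ^ (-s) := by
        refine Finset.sum_congr rfl fun x _ => ?_
        simp only [Φ, map_mul, Nat.cast_mul]
        have e : (absNorm x.1 : ℝ) ^ (-(2 * s)) =
            (absNorm x.1 : ℝ) ^ (-s) * (absNorm x.1 : ℝ) ^ (-s) := by
          rcases (Nat.cast_nonneg (absNorm x.1) : (0 : ℝ) ≤ _).eq_or_lt with h | h
          · rw [← h, Real.zero_rpow (by linarith), Real.zero_rpow (by linarith), zero_mul]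
          · rw [← Real.rpow_add h]; congr 1; ring
        rw [e, Real.mul_rpow (by positivity) (by positivity),
          Real.mul_rpow (by positivity) (by positivity),
          Real.mul_rpow (by positivity) (by positivity)]
        ring
    _ = ∑ y ∈ ((G.erase ⊥) ×ˢ P).image Φ, (absNorm y.1 : ℝ) ^ (-s) * (absNorm y.2 : ℝ) ^ (-s) := by
        rw [Finset.sum_image hinj]
    _ ≤ _ := sum_le_hasSum _ (fun _ _ => by positivity) hprod

end Zeta

/-! ### Comparing a sum with an integral. -/

section Smearing

open MeasureTheory

/-- A sum over the centres of disjoint translates of a symmetric set is bounded by an integral. -/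
theorem mul_measureReal_mul_sum_le_integral {E : Type*} [AddCommGroup E] [MeasurableSpace E]
    [MeasurableAdd E] [MeasurableNeg E] {μ : Measure E} [μ.IsAddLeftInvariant] [μ.IsNegInvariant]
    {f : E → ℝ} (hf : Integrable f μ) (hf0 : ∀ x, 0 ≤ f x) {P : Set E} (hP : MeasurableSet P)
    (hPμ : μ P ≠ ⊤) (hsymm : ∀ x ∈ P, -x ∈ P) {c : ℝ} (F : Finset E)
    (hdisj : ∀ y ∈ F, ∀ z ∈ F, ∀ x, x - y ∈ P → x - z ∈ P → y = z)
    (hc : ∀ y ∈ F, ∀ x ∈ P, 2 * c * f y ≤ f (y + x) + f (y - x)) :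
    c * μ.real P * ∑ y ∈ F, f y ≤ ∫ x, f x ∂μ := by
  classical
  have hsub : ∀ y : E, Measurable fun x : E => x - y := fun y => by
    simpa only [sub_eq_add_neg] using measurable_add_const (-y)
  have hi : ∀ y, Integrable (fun x => P.indicator (1 : E → ℝ) (x - y) * f x) μ := by
    intro y
    have e : (fun x => P.indicator (1 : E → ℝ) (x - y) * f x) =
        ((fun x => x - y) ⁻¹' P).indicator f := by
      funext x; by_cases h : x - y ∈ P <;> simp [h]
    rw [e]
    exact hf.indicator (hsub y hP)
  have h1 : ∑ y ∈ F, ∫ x, P.indicator (1 : E → ℝ) (x - y) * f x ∂μ ≤ ∫ x, f x ∂μ := by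
    rw [← integral_finsetSum _ fun y _ => hi y]
    refine integral_mono (integrable_finsetSum _ fun y _ => hi y) hf fun x => ?_
    simp only
    rw [← Finset.sum_mul]
    by_cases h : ∃ y ∈ F, x - y ∈ P
    · obtain ⟨y, hy, hxy⟩ := h
      rw [Finset.sum_eq_single_of_mem y hy fun z hz hne => ?_]
      · simp [hxy]
      · exact Set.indicator_of_notMem (fun hxz => hne (hdisj z hz y hy x hxz hxy)) _
    · push Not at h
      rw [Finset.sum_eq_zero fun y hy => Set.indicator_of_notMem (h y hy) _, zero_mul]
      exact hf0 x
  refine le_trans ?_ h1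
  rw [Finset.mul_sum]
  refine Finset.sum_le_sum fun y hy => ?_
  have e1 : ∫ x, P.indicator (1 : E → ℝ) (x - y) * f x ∂μ =
      ∫ x, P.indicator (1 : E → ℝ) x * f (y + x) ∂μ := by
    rw [← integral_add_left_eq_self _ y]
    simp
  -- By symmetry of P the reflected translate gives the same integral, so only the average of f at y
  -- + x and y - x has to be controlled.
  have e2 : ∫ x, P.indicator (1 : E → ℝ) (x - y) * f x ∂μ =
      ∫ x, P.indicator (1 : E → ℝ) x * f (y - x) ∂μ := by
    rw [e1, ← integral_neg_eq_self]
    refine integral_congr_ae (Filter.Eventually.of_forall fun x => ?_)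
    have : P.indicator (1 : E → ℝ) (-x) = P.indicator 1 x := by
      by_cases h : x ∈ P
      · rw [Set.indicator_of_mem h, Set.indicator_of_mem (hsymm x h)]; rfl
      · rw [Set.indicator_of_notMem h, Set.indicator_of_notMem]
        intro h'
        exact h (by simpa using hsymm _ h')
    simp only [this, ← sub_eq_add_neg]
  have i1 : Integrable (fun x => P.indicator (1 : E → ℝ) x * f (y + x)) μ := by
    simpa using (hi y).comp_add_left y
  have i2 : Integrable (fun x => P.indicator (1 : E → ℝ) x * f (y - x)) μ := by
    have := i1.comp_neg
    refine this.congr (Filter.Eventually.of_forall fun x => ?_)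
    have : P.indicator (1 : E → ℝ) (-x) = P.indicator 1 x := by
      by_cases h : x ∈ P
      · rw [Set.indicator_of_mem h, Set.indicator_of_mem (hsymm x h)]; rfl
      · rw [Set.indicator_of_notMem h, Set.indicator_of_notMem]
        intro h'
        exact h (by simpa using hsymm _ h')
    simp only [this, ← sub_eq_add_neg]
  have h2 : ∫ x, P.indicator (fun _ => 2 * c * f y) x ∂μ ≤
      ∫ x, (P.indicator (1 : E → ℝ) x * f (y + x) + P.indicator (1 : E → ℝ) x * f (y - x)) ∂μ := by
    refine integral_mono ((integrable_indicator_iff hP).2 (integrableOn_const hPμ)) (i1.add i2)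
      fun x => ?_
    by_cases h : x ∈ P
    · simpa [h] using hc y hy x h
    · simp [h]
  rw [integral_add i1 i2, ← e1, ← e2, integral_indicator_const _ hP, smul_eq_mul] at h2
  linarith

theorem isNegInvariant_of_isAddHaarMeasure {E : Type*} [NormedAddCommGroup E] [NormedSpace ℝ E]
    [FiniteDimensional ℝ E] [MeasurableSpace E] [BorelSpace E] (μ : Measure E)
    [μ.IsAddHaarMeasure] : μ.IsNegInvariant := by
  have : ProperSpace E := FiniteDimensional.proper_real E
  infer_instance

end Smearing

/-! ### Packing cross-polytopes around the points of an inverse ideal. -/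

section IdealPacking

open NumberField NumberField.InfinitePlace NumberField.mixedEmbedding MeasureTheory Module Ideal
open scoped Classical

variable {K : Type*} [Field K]

theorem normAtPlace_parallelogram (w : InfinitePlace K) (x y : mixedSpace K) :
    normAtPlace w (x + y) ^ 2 + normAtPlace w (x - y) ^ 2 =
      2 * (normAtPlace w x ^ 2 + normAtPlace w y ^ 2) := by
  rcases isReal_or_isComplex w with hw | hw
  · simp only [normAtPlace_apply_of_isReal hw, Prod.fst_add, Prod.fst_sub, Pi.add_apply,
      Pi.sub_apply, Real.norm_eq_abs, sq_abs]
    ring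
  · simp only [normAtPlace_apply_of_isComplex hw, Prod.snd_add, Prod.snd_sub, Pi.add_apply,
      Pi.sub_apply]
    have := parallelogram_law_with_norm ℝ (x.2 ⟨w, hw⟩) (y.2 ⟨w, hw⟩)
    nlinarith

variable [NumberField K]

/-- The weight function of the packing argument. -/
noncomputable def psi (x : mixedSpace K) : ℝ :=
  ∏ w : InfinitePlace K, (4 / (3 + normAtPlace w x ^ 2)) ^ (2 * mult w)

theorem psi_pos (x : mixedSpace K) : 0 < psi x :=
  Finset.prod_pos fun w _ => by positivity

theorem psi_mixedEmbedding (α : K) : psi (mixedEmbedding K α) = (meanNorm (3 / 4) α ^ 4)⁻¹ := by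
  rw [psi, meanNorm, ← Finset.prod_pow, ← Finset.prod_inv_distrib]
  refine Finset.prod_congr rfl fun w _ => ?_
  rw [normAtPlace_apply, ← pow_mul, mul_comm (mult w) 4, show 4 * mult w = 2 * (2 * mult w) by ring,
    pow_mul (√(3 / 4 + (1 - 3 / 4) * w α ^ 2)) 2, Real.sq_sqrt (by positivity), ← inv_pow]
  congr 1
  rw [← inv_div]
  congr 1
  ring

theorem psi_eq (x : mixedSpace K) : psi x =
    (∏ w, (fun y : ℝ => (4 / (3 + y ^ 2)) ^ 2) (x.1 w)) *
      ∏ w, (fun z : ℂ => (4 / (3 + ‖z‖ ^ 2)) ^ 4) (x.2 w) := by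
  rw [psi, prod_place_eq]
  congr 1
  · refine Finset.prod_congr rfl fun w _ => ?_
    rw [normAtPlace_apply_of_isReal w.2, mult_isReal, Real.norm_eq_abs, sq_abs]
  · refine Finset.prod_congr rfl fun w _ => ?_
    rw [normAtPlace_apply_of_isComplex w.2, mult_isComplex]

theorem integrable_psi : Integrable (psi : mixedSpace K → ℝ) := by
  have h1 := Integrable.fintype_prod (ι := {w : InfinitePlace K // IsReal w})
    (μ := fun _ => (volume : Measure ℝ)) fun _ => integrable_and_integral_real.1
  have h2 := Integrable.fintype_prod (ι := {w : InfinitePlace K // IsComplex w})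
    (μ := fun _ => (volume : Measure ℂ)) fun _ => integrable_and_integral_complex.1
  refine (h1.mul_prod h2).congr (Filter.Eventually.of_forall fun x => ?_)
  exact (psi_eq x).symm

theorem integral_psi : ∫ x : mixedSpace K, psi x =
    (8 * Real.pi * √3 / 9) ^ nrRealPlaces K * (256 * Real.pi / 81) ^ nrComplexPlaces K := by
  simp_rw [psi_eq]
  rw [Measure.volume_eq_prod, integral_prod_mul
    (fun x : {w : InfinitePlace K // IsReal w} → ℝ => ∏ w, (fun y : ℝ => (4 / (3 + y ^ 2)) ^ 2) (x w))
    (fun x : {w : InfinitePlace K // IsComplex w} → ℂ =>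
      ∏ w, (fun z : ℂ => (4 / (3 + ‖z‖ ^ 2)) ^ 4) (x w)),
    integral_fintype_prod_volume_eq_pow (fun y : ℝ => (4 / (3 + y ^ 2)) ^ 2),
    integral_fintype_prod_volume_eq_pow (fun z : ℂ => (4 / (3 + ‖z‖ ^ 2)) ^ 4),
    integrable_and_integral_real.2, integrable_and_integral_complex.2]

/-- At each place the parallelogram law and AM-GM bound the product of the two denominators by (3 +
p + q)², where p = |x|² and q = |y|², and 3 + p + q ≤ (3 + p)(1 + q/3). -/
theorem psi_add_mul_psi_sub_ge (x y : mixedSpace K) :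
    (psi x / ∏ w : InfinitePlace K, (1 + normAtPlace w y ^ 2 / 3) ^ (2 * mult w)) ^ 2 ≤
      psi (x + y) * psi (x - y) := by
  rw [psi, psi, psi, ← Finset.prod_div_distrib, ← Finset.prod_mul_distrib, ← Finset.prod_pow]
  refine Finset.prod_le_prod (fun w _ => by positivity) fun w _ => ?_
  rw [← div_pow, ← mul_pow, ← pow_mul, mul_comm (2 * mult w) 2, pow_mul]
  refine pow_le_pow_left₀ (by positivity) ?_ _
  have h := normAtPlace_parallelogram w x y
  rw [div_div, div_pow, div_mul_div_comm, div_le_div_iff₀ (by positivity) (by positivity)]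
  set a := normAtPlace w (x + y) ^ 2
  set b := normAtPlace w (x - y) ^ 2
  set p := normAtPlace w x ^ 2
  set q := normAtPlace w y ^ 2
  have hp : 0 ≤ p := sq_nonneg _
  have hq : 0 ≤ q := sq_nonneg _
  have h1 : (3 + a) * (3 + b) ≤ (3 + p + q) ^ 2 := by nlinarith [sq_nonneg (a - b)]
  have h2 : (3 + p + q) ^ 2 ≤ ((3 + p) * (1 + q / 3)) ^ 2 := by
    apply pow_le_pow_left₀ (by positivity)
    nlinarith [mul_nonneg hp hq]
  nlinarith

theorem prod_one_add_sq_le_exp {ρ s : ℝ} (hs : s = min ρ (2 / 3 * ρ ^ 2)) {y : mixedSpace K}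
    (hy : convexBodySumFun y ≤ ρ) :
    ∏ w : InfinitePlace K, (1 + normAtPlace w y ^ 2 / 3) ^ (2 * mult w) ≤ Real.exp s := by
  have hnn : ∀ w : InfinitePlace K, 0 ≤ normAtPlace w y := fun w => normAtPlace_nonneg w y
  rw [hs, convexBodySumFun_apply] at *
  have e : ∏ w : InfinitePlace K, (1 + normAtPlace w y ^ 2 / 3) ^ (2 * mult w) =
      ∏ w : InfinitePlace K, ((1 + normAtPlace w y ^ 2 / 3) ^ 2) ^ mult w := by
    simp only [pow_mul]
  rw [e]
  rcases min_cases ρ (2 / 3 * ρ ^ 2) with ⟨h, -⟩ | ⟨h, -⟩ <;> rw [h]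
  · calc _ ≤ ∏ w : InfinitePlace K, Real.exp (normAtPlace w y) ^ mult w :=
          Finset.prod_le_prod (fun w _ => by positivity) fun w _ =>
            pow_le_pow_left₀ (by positivity) (one_add_sq_le_exp (hnn w)) _
      _ = Real.exp (∑ w : InfinitePlace K, mult w * normAtPlace w y) := by
          rw [Real.exp_sum]
          exact Finset.prod_congr rfl fun w _ => by rw [← Real.exp_nat_mul]
      _ ≤ _ := Real.exp_le_exp.2 hy
  · have hsq : ∑ w : InfinitePlace K, (mult w : ℝ) * normAtPlace w y ^ 2 ≤ ρ ^ 2 := by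
      refine le_trans ?_ (pow_le_pow_left₀
        (Finset.sum_nonneg fun w _ => mul_nonneg (Nat.cast_nonneg _) (hnn w)) hy 2)
      refine le_trans ?_ (Finset.sum_sq_le_sq_sum_of_nonneg fun w _ => mul_nonneg (Nat.cast_nonneg _) (hnn w))
      refine Finset.sum_le_sum fun w _ => ?_
      rw [mul_pow]
      gcongr
      have : (1 : ℝ) ≤ mult w := by exact_mod_cast one_le_mult
      nlinarith
    calc _ ≤ ∏ w : InfinitePlace K, Real.exp (2 / 3 * normAtPlace w y ^ 2) ^ mult w :=
          Finset.prod_le_prod (fun w _ => by positivity) fun w _ =>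
            pow_le_pow_left₀ (by positivity) (one_add_sq_le_exp_sq _) _
      _ = Real.exp (2 / 3 * ∑ w : InfinitePlace K, mult w * normAtPlace w y ^ 2) := by
          rw [Finset.mul_sum, Real.exp_sum]
          exact Finset.prod_congr rfl fun w _ => by rw [← Real.exp_nat_mul]; congr 1; ring
      _ ≤ _ := Real.exp_le_exp.2 (by linarith)

/-- AM-GM over the places, weighted by multiplicity: a lower bound on the norm separates points in
the ℓ¹ sense. -/
theorem finrank_mul_le_convexBodySumFun {x : mixedSpace K} {k : ℝ} (hk : 0 ≤ k)
    (h : k ^ finrank ℚ K ≤ mixedEmbedding.norm x) :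
    finrank ℚ K * k ≤ convexBodySumFun x := by
  have hd : (0 : ℝ) < finrank ℚ K := by exact_mod_cast finrank_pos
  have h1 := Real.geom_mean_le_arith_mean Finset.univ (fun w : InfinitePlace K => (mult w : ℝ))
    (fun w => normAtPlace w x) (fun _ _ => Nat.cast_nonneg _)
    (by rw [← Nat.cast_sum, sum_mult_eq]; exact hd) (fun w _ => normAtPlace_nonneg w x)
  simp only [Real.rpow_natCast, ← Nat.cast_sum, sum_mult_eq] at h1
  rw [← mixedEmbedding.norm_apply, le_div_iff₀ hd] at h1
  have h2 : k ≤ mixedEmbedding.norm x ^ (finrank ℚ K : ℝ)⁻¹ := by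
    rw [Real.le_rpow_inv_iff_of_pos hk (mixedEmbedding.norm_nonneg x) hd, Real.rpow_natCast]
    exact h
  rw [convexBodySumFun_apply]
  nlinarith

/-- The norm is D(x⁻¹)/D(x), where D(x⁻¹) ≥ 1 and D(x) divides N(b). -/
theorem one_div_le_norm_of_mul_mem {x : K} (hx : x ≠ 0) {b : Ideal (𝓞 K)} (hb : b ≠ ⊥)
    (h : b ≤ denIdeal x) : 1 / (absNorm b : ℝ) ≤ mixedEmbedding.norm (mixedEmbedding K x) := by
  let α : Kˣ := Units.mk0 x hx
  have hb0 : 0 < absNorm b := Nat.pos_of_ne_zero (absNorm_eq_zero_iff.not.2 hb)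
  have e : mixedEmbedding.norm (mixedEmbedding K x) = denomIndex K α⁻¹ / denomIndex K α := by
    rw [← prod_place_eq_denomIndex_div, mixedEmbedding.norm_apply]
    simp only [normAtPlace_apply]
    rfl
  have h1 : denomIndex K α ≤ absNorm b := by
    rw [denomIndex_eq_absNorm]
    exact Nat.le_of_dvd hb0 (absNorm_dvd_absNorm_of_le h)
  have h2 := denomIndex_pos α
  have h3 := denomIndex_pos α⁻¹
  rw [e, div_le_div_iff₀ (by exact_mod_cast hb0) (by exact_mod_cast h2)]
  have h4 : 1 * denomIndex K α ≤ denomIndex K α⁻¹ * absNorm b := Nat.mul_le_mul h3 h1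
  exact_mod_cast h4

theorem volume_convexBodySum_lt {ρ : ℝ} (hρ : 0 ≤ ρ) :
    volume.real {x : mixedSpace K | convexBodySumFun x < ρ} =
      2 ^ nrRealPlaces K * (Real.pi / 2) ^ nrComplexPlaces K / (finrank ℚ K).factorial *
        ρ ^ finrank ℚ K := by
  have h := convexBodySum_volume K ρ
  rw [MeasureTheory.measure_le_eq_lt _ ((convexBodySumFun_eq_zero_iff 0).mpr rfl)
    convexBodySumFun_neg convexBodySumFun_add_le
    (fun hx => (convexBodySumFun_eq_zero_iff _).mp hx)
    (fun r x => le_of_eq (convexBodySumFun_smul r x))] at h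
  rw [Measure.real, h, ENNReal.toReal_mul, ENNReal.toReal_pow, ENNReal.toReal_ofReal hρ]
  simp [convexBodySumFactor]

/-- The sum of the weights of the elements with a given denominator of large norm. -/
theorem sum_inv_meanNorm_pow_le {b : Ideal (𝓞 K)} (hb : b ≠ ⊥) (F : Finset Kˣ)
    (hF : ∀ α ∈ F, denIdeal (α : K) = b) (hlarge : (19 / 5 : ℝ) ^ finrank ℚ K ≤ absNorm b ^ 2) :
    ∑ α ∈ F, (meanNorm (3 / 4) (α : K) ^ 4)⁻¹ ≤
      (if Units.rank K = 0 then 2 else 1) * (absNorm b : ℝ) ^ 3 := by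
  set d := finrank ℚ K with hd
  have hd0 : 0 < d := finrank_pos
  have hdR : (0 : ℝ) < d := by exact_mod_cast hd0
  have hN0 : (0 : ℝ) < absNorm b := by
    exact_mod_cast Nat.pos_of_ne_zero (absNorm_eq_zero_iff.not.2 hb)
  set N : ℝ := ((absNorm b : ℕ) : ℝ) with hN
  set k : ℝ := N ^ (d : ℝ)⁻¹ with hk
  have hk0 : 0 < k := by positivity
  have hkd : k ^ d = N := Real.rpow_inv_natCast_pow hN0.le hd0.ne'
  have hk2 : 19 / 5 ≤ k ^ 2 := by
    rw [← pow_le_pow_iff_left₀ (by norm_num) (by positivity) hd0.ne', ← pow_mul, mul_comm, pow_mul,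
      hkd]
    exact hlarge
  -- Half the guaranteed ℓ¹ distance d/k between distinct points of b⁻¹, so the open cross-polytopes
  -- of radius ρ are disjoint.
  set ρ : ℝ := d / (2 * k) with hρ
  have hρ0 : 0 < ρ := by positivity
  set s := min ρ (2 / 3 * ρ ^ 2) with hs
  set P : Set (mixedSpace K) := {x | convexBodySumFun x < ρ} with hP
  have hinj : Function.Injective fun α : Kˣ => mixedEmbedding K (α : K) := fun α β h =>
    Units.ext (mixedEmbedding_injective K h)
  have hvol := volume_convexBodySum_lt (K := K) hρ0.le
  have : (volume : Measure (mixedSpace K)).IsNegInvariant := isNegInvariant_of_isAddHaarMeasure _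
  have hpack := mul_measureReal_mul_sum_le_integral (μ := (volume : Measure (mixedSpace K)))
    integrable_psi (fun x => (psi_pos x).le) (P := P) (c := Real.exp (-s))
    ((convexBodySumFun_continuous K).measurable measurableSet_Iio)
    (((convexBodySum_isBounded K ρ).subset fun x (hx : convexBodySumFun x < ρ) =>
      hx.le).measure_lt_top.ne)
    (fun x (hx : convexBodySumFun x < ρ) => by
      change convexBodySumFun (-x) < ρ
      rwa [convexBodySumFun_neg])
    (F.image fun α : Kˣ => mixedEmbedding K (α : K)) (by
      intro y hy z hz x hxy hxz
      obtain ⟨α, hα, rfl⟩ := Finset.mem_image.1 hy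
      obtain ⟨β, hβ, rfl⟩ := Finset.mem_image.1 hz
      by_contra hne
      have hαβ : (α : K) - β ≠ 0 := fun h => hne (by simp only [sub_eq_zero.1 h])
      have h1 : b ≤ denIdeal ((α : K) - β) := by
        intro c hc
        obtain ⟨u, hu⟩ := mem_denIdeal.1 ((hF α hα).symm ▸ hc)
        obtain ⟨v, hv⟩ := mem_denIdeal.1 ((hF β hβ).symm ▸ hc)
        exact ⟨u - v, by
          simp only [RingOfIntegers.coe_eq_algebraMap] at *
          rw [sub_mul, hu, hv, map_sub]⟩
      have h2 := one_div_le_norm_of_mul_mem hαβ hb h1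
      have h3 : d * k⁻¹ ≤ convexBodySumFun (mixedEmbedding K ((α : K) - β)) := by
        refine finrank_mul_le_convexBodySumFun (inv_nonneg.2 hk0.le) ?_
        rw [inv_pow, hkd, ← one_div]
        exact h2
      have h4 : convexBodySumFun (mixedEmbedding K ((α : K) - β)) < ρ + ρ := by
        have e : mixedEmbedding K ((α : K) - β) =
            (x - mixedEmbedding K (β : K)) + -(x - mixedEmbedding K (α : K)) := by
          rw [map_sub]; abel
        rw [e]
        refine (convexBodySumFun_add_le _ _).trans_lt ?_
        rw [convexBodySumFun_neg]
        exact add_lt_add hxz hxy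
      have e : d * k⁻¹ = ρ + ρ := by rw [hρ]; field_simp; norm_num
      linarith)
    (by
      intro y _ x hx
      have hE := prod_one_add_sq_le_exp hs (le_of_lt hx)
      have h1 := psi_add_mul_psi_sub_ge y x
      have hprod : 0 < ∏ w : InfinitePlace K, (1 + normAtPlace w x ^ 2 / 3) ^ (2 * mult w) :=
        Finset.prod_pos fun w _ => by positivity
      have h2 : Real.exp (-s) * psi y ≤
          psi y / ∏ w : InfinitePlace K, (1 + normAtPlace w x ^ 2 / 3) ^ (2 * mult w) := by
        rw [Real.exp_neg, mul_comm, ← div_eq_mul_inv]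
        exact div_le_div_of_nonneg_left (psi_pos y).le hprod hE
      have h3 := pow_le_pow_left₀ (mul_pos (Real.exp_pos (-s)) (psi_pos y)).le h2 2
      have h4 := psi_pos (y + x)
      have h5 := psi_pos (y - x)
      -- AM-GM turns the lower bound for the product into one for the sum.
      have h6 : (2 * Real.exp (-s) * psi y) ^ 2 ≤ (psi (y + x) + psi (y - x)) ^ 2 := by
        nlinarith [sq_nonneg (psi (y + x) - psi (y - x))]
      exact le_of_sq_le_sq h6 (by positivity))
  rw [Finset.sum_image fun α _ β _ h => hinj h, integral_psi, hvol] at hpack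
  simp only [psi_mixedEmbedding] at hpack
  have hsig : d = nrRealPlaces K + 2 * nrComplexPlaces K := (card_add_two_mul_card_eq_rank K).symm
  have hcard : nrRealPlaces K + nrComplexPlaces K = Units.rank K + 1 := by
    rw [Units.rank, ← card_eq_nrRealPlaces_add_nrComplexPlaces]
    exact (Nat.sub_add_cancel Fintype.card_pos).symm
  have hconst := packing_constant_le hsig (by omega) hk0 hk2 (s := s) (min_le_left _ _) (by
    refine (min_le_right _ _).trans_eq ?_
    rw [hρ]; field_simp; norm_num)
  have hif : (if nrRealPlaces K + nrComplexPlaces K = 1 then (2 : ℝ) else 1) =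
      if Units.rank K = 0 then 2 else 1 := by
    rw [hcard]; simp
  rw [hif] at hconst
  set β : ℝ := if Units.rank K = 0 then 2 else 1
  have hβ0 : 0 < β := by simp only [β]; split_ifs <;> norm_num
  set Tψ := ∑ α ∈ F, (meanNorm (3 / 4) (α : K) ^ 4)⁻¹
  have hpow : ρ ^ d = d ^ d / (2 ^ nrRealPlaces K * 4 ^ nrComplexPlaces K * N) := by
    rw [hρ, div_pow, mul_pow, hkd]
    congr 2
    conv_lhs => rw [hsig]
    rw [pow_add, pow_mul]; norm_num
  have hfac : (0 : ℝ) < d.factorial := by exact_mod_cast d.factorial_pos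
  have hdd : (0 : ℝ) < (d : ℝ) ^ d := by positivity
  have e1 : (2 : ℝ) ^ nrRealPlaces K * (Real.pi / 2) ^ nrComplexPlaces K / d.factorial * ρ ^ d =
      (Real.pi / 8) ^ nrComplexPlaces K * d ^ d / (N * d.factorial) := by
    have : (Real.pi / 2) ^ nrComplexPlaces K =
        (Real.pi / 8) ^ nrComplexPlaces K * 4 ^ nrComplexPlaces K := by
      rw [← mul_pow]; congr 1; ring
    rw [hpow, this]
    field_simp
  have e2 : (256 * Real.pi / 81 : ℝ) ^ nrComplexPlaces K =
      (Real.pi / 8) ^ nrComplexPlaces K * (2048 / 81) ^ nrComplexPlaces K := by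
    rw [← mul_pow]; congr 1; ring
  rw [e1, e2, Real.exp_neg] at hpack
  have hπ : 0 < (Real.pi / 8) ^ nrComplexPlaces K := by positivity
  have hE := Real.exp_pos s
  have h7 : Tψ * d ^ d ≤ Real.exp s * ((8 * Real.pi * √3 / 9) ^ nrRealPlaces K *
      (2048 / 81) ^ nrComplexPlaces K) * d.factorial * N := by
    have : (Real.exp s)⁻¹ * ((Real.pi / 8) ^ nrComplexPlaces K * d ^ d / (N * d.factorial)) * Tψ =
        (Tψ * d ^ d) * ((Real.pi / 8) ^ nrComplexPlaces K / (Real.exp s * (N * d.factorial))) := by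
      field_simp
    rw [this, ← le_div_iff₀ (by positivity)] at hpack
    refine hpack.trans_eq ?_
    field_simp
  have h8 : Tψ * d ^ d ≤ (β * N ^ 3) * d ^ d := by
    calc _ ≤ β * (19 / 5) ^ d * d ^ d * N := h7.trans (by gcongr)
      _ ≤ β * N ^ 2 * d ^ d * N := by gcongr
      _ = _ := by ring
  exact le_of_mul_le_mul_right h8 hdd

end IdealPacking

/-! ### Bounds for a single term. -/

section Terms

open NumberField NumberField.InfinitePlace Module Ideal Real

variable {K : Type*} [Field K]

/-- The height of numerator and denominator, `log N(a) + log N(b)` for `(α) = a / b`. -/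
noncomputable def logDenoms (α : Kˣ) : ℝ := log (denomIndex K α) + log (denomIndex K α⁻¹)

theorem logDenoms_nonneg (α : Kˣ) : 0 ≤ logDenoms α :=
  add_nonneg (log_natCast_nonneg _) (log_natCast_nonneg _)

theorem logDenoms_inv (α : Kˣ) : logDenoms α⁻¹ = logDenoms α := by
  rw [logDenoms, logDenoms, inv_inv, add_comm]

variable [NumberField K]

/-- The summand belonging to `α`. -/
noncomputable def latticeTerm (t : ℕ) (R : ℝ) (α : Kˣ) : ℝ :=
  ((denomIndex K α : ℝ) ^ t)⁻¹ * vol (ball K t R ∩ scale ((α⁻¹ : Kˣ) : K) (ball K t R))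

theorem vol_nonneg {t : ℕ} (A : Set (Fin t → mixedEmbedding.mixedSpace K)) : 0 ≤ vol A :=
  MeasureTheory.measureReal_nonneg

theorem latticeTerm_nonneg (t : ℕ) (R : ℝ) (α : Kˣ) : 0 ≤ latticeTerm t R α :=
  mul_nonneg (by positivity) (vol_nonneg _)

theorem latticeTerm_le {t : ℕ} {R a : ℝ} (h0 : 0 ≤ a) (h1 : a ≤ 1) (α : Kˣ) :
    latticeTerm t R α ≤ ((denomIndex K α * meanNorm a (α : K))⁻¹) ^ t * vol (ball K t R) := by
  rw [latticeTerm, inv_pow, mul_pow, mul_inv, mul_assoc]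
  exact mul_le_mul_of_nonneg_left (vol_inter_scale_le h0 h1 α) (by positivity)

theorem denomIndex_mul_meanNorm_pos {a : ℝ} (h0 : 0 ≤ a) (h1 : a ≤ 1) (α : Kˣ) :
    0 < denomIndex K α * meanNorm a (α : K) :=
  mul_pos (by exact_mod_cast denomIndex_pos α) (meanNorm_pos h0 h1 α)

theorem meanNorm_sq {a : ℝ} (h0 : 0 ≤ a) (h1 : a ≤ 1) (α : Kˣ) :
    meanNorm a (α : K) ^ 2 = ∏ w : InfinitePlace K, (a + (1 - a) * w (α : K) ^ 2) ^ mult w := by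
  rw [meanNorm, ← Finset.prod_pow]
  refine Finset.prod_congr rfl fun w _ => ?_
  rw [← pow_mul, mul_comm (mult w) 2, pow_mul, sq_sqrt (mean_pos h0 h1 α w).le]

/-- Inversion only swaps the weights, so the family of bounds over all a is the same for α and α⁻¹.
This permits assuming D(α⁻¹) ≤ D(α). -/
theorem denomIndex_mul_meanNorm_inv {a : ℝ} (h0 : 0 ≤ a) (h1 : a ≤ 1) (α : Kˣ) :
    denomIndex K α⁻¹ * meanNorm (1 - a) ((α⁻¹ : Kˣ) : K) =
      denomIndex K α * meanNorm a (α : K) := by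
  have h0' : 0 ≤ 1 - a := by linarith
  have h1' : 1 - a ≤ 1 := by linarith
  refine (pow_left_inj₀ (denomIndex_mul_meanNorm_pos h0' h1' α⁻¹).le
    (denomIndex_mul_meanNorm_pos h0 h1 α).le two_ne_zero).1 ?_
  rw [mul_pow, mul_pow, meanNorm_sq h0' h1', meanNorm_sq h0 h1]
  have hA : (denomIndex K α⁻¹ : ℝ) =
      denomIndex K α * ∏ w : InfinitePlace K, w (α : K) ^ mult w := by
    have : (denomIndex K α : ℝ) ≠ 0 := by exact_mod_cast (denomIndex_pos α).ne'
    rw [prod_place_eq_denomIndex_div]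
    field_simp
  rw [hA, mul_pow, mul_assoc, ← Finset.prod_pow, ← Finset.prod_mul_distrib]
  congr 1
  refine Finset.prod_congr rfl fun w _ => ?_
  rw [← pow_mul, mul_comm (mult w) 2, pow_mul, ← mul_pow]
  congr 1
  have hw : w (α : K) ≠ 0 := (w.pos_iff.2 α.ne_zero).ne'
  rw [Units.val_inv_eq_inv_val, map_inv₀]
  field_simp
  ring

theorem exp_logDenoms (α : Kˣ) : exp (logDenoms α) = denomIndex K α * denomIndex K α⁻¹ := by
  rw [logDenoms, exp_add, exp_log (by exact_mod_cast denomIndex_pos α),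
    exp_log (by exact_mod_cast denomIndex_pos α⁻¹)]

/-- Since (1 + x²)/2 = x cosh(log x), the product formula turns the square of D(α) times the mean
norm into D(α)D(α⁻¹) ∏ cosh(log|α|_w); Jensen bounds the product below. -/
theorem le_log_denomIndex_mul_meanNorm (α : Kˣ) :
    1 / 2 * (logDenoms α + finrank ℚ K *
      log (cosh (2 * weilHeight K (α : K) - logDenoms α / finrank ℚ K))) ≤
      log (denomIndex K α * meanNorm (1 / 2) (α : K)) := by
  have hd : (0 : ℝ) < finrank ℚ K := by exact_mod_cast finrank_pos
  have hD : (0 : ℝ) < denomIndex K α := by exact_mod_cast denomIndex_pos α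
  have hA : (0 : ℝ) < denomIndex K α⁻¹ := by exact_mod_cast denomIndex_pos α⁻¹
  have hpos := denomIndex_mul_meanNorm_pos (a := 1 / 2) (by norm_num) (by norm_num) α
  have h1 := cosh_weighted_mean_pow_le_prod Finset.univ (fun w : InfinitePlace K => mult w)
    (fun w => log (w (α : K))) (finrank ℚ K) finrank_pos sum_mult_eq
  have e1 : (∑ w : InfinitePlace K, (mult w : ℝ) * |log (w (α : K))|) / finrank ℚ K =
      2 * weilHeight K (α : K) - logDenoms α / finrank ℚ K := by
    rw [sum_abs_log_place, logDenoms]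
    field_simp
  rw [e1] at h1
  have e2 : (denomIndex K α * meanNorm (1 / 2) (α : K)) ^ 2 =
      (denomIndex K α * denomIndex K α⁻¹) * ∏ w : InfinitePlace K, cosh (log (w (α : K))) ^ mult w := by
    have hA : (denomIndex K α⁻¹ : ℝ) =
        denomIndex K α * ∏ w : InfinitePlace K, w (α : K) ^ mult w := by
      rw [prod_place_eq_denomIndex_div]
      field_simp
    rw [mul_pow, meanNorm_sq (by norm_num) (by norm_num), hA, ← mul_assoc, ← pow_two, mul_assoc,
      ← Finset.prod_mul_distrib]
    congr 1
    refine Finset.prod_congr rfl fun w _ => ?_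
    rw [← mul_pow]
    congr 1
    have hw : 0 < w (α : K) := w.pos_iff.2 α.ne_zero
    rw [cosh_log hw]
    field_simp
    ring
  have h2 : exp (logDenoms α) * cosh (2 * weilHeight K (α : K) - logDenoms α / finrank ℚ K) ^
      finrank ℚ K ≤ (denomIndex K α * meanNorm (1 / 2) (α : K)) ^ 2 := by
    rw [e2, exp_logDenoms]
    gcongr
  have h3 := log_le_log (mul_pos (exp_pos _) (pow_pos (cosh_pos _) _)) h2
  rw [log_mul (exp_pos _).ne' (pow_pos (cosh_pos _) _).ne', log_exp, log_pow, log_pow] at h3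
  push_cast at h3
  linarith

theorem latticeTerm_le_exp (t : ℕ) (R : ℝ) (α : Kˣ) :
    latticeTerm t R α ≤ exp (-(1 / 2 * (logDenoms α + finrank ℚ K *
      log (cosh (2 * weilHeight K (α : K) - logDenoms α / finrank ℚ K))))) ^ t *
        vol (ball K t R) := by
  refine (latticeTerm_le (a := 1 / 2) (by norm_num) (by norm_num) α).trans ?_
  have hpos := denomIndex_mul_meanNorm_pos (a := 1 / 2) (by norm_num) (by norm_num) α
  refine mul_le_mul_of_nonneg_right (pow_le_pow_left₀ (inv_pos.2 hpos).le ?_ _) (vol_nonneg _)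
  rw [← exp_log hpos, ← exp_neg]
  exact exp_le_exp.2 (neg_le_neg (le_log_denomIndex_mul_meanNorm α))

/-- The elements for which the geometric bound alone suffices. -/
def IsBalanced (α : Kˣ) : Prop :=
  log (cosh (3 * weilHeight K (α : K) / 2)) ≤ logDenoms α / finrank ℚ K / 2 +
    log (cosh (2 * weilHeight K (α : K) - logDenoms α / finrank ℚ K))

theorem isBalanced_inv {α : Kˣ} : IsBalanced α⁻¹ ↔ IsBalanced α := by
  rw [IsBalanced, IsBalanced, logDenoms_inv, weilHeight_inv]

theorem lt_of_not_isBalanced {α : Kˣ} (h : ¬ IsBalanced α) :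
    (19 / 5 : ℝ) ^ finrank ℚ K < denomIndex K α * denomIndex K α⁻¹ := by
  have hd : (0 : ℝ) < finrank ℚ K := by exact_mod_cast finrank_pos
  have hm : 0 ≤ logDenoms α / finrank ℚ K := div_nonneg (logDenoms_nonneg α) hd.le
  have h1 : 19 / 5 < exp (logDenoms α / finrank ℚ K) := by
    by_contra hle
    push Not at hle
    apply h
    have := cosh_le_exp_mul_cosh_of_exp_le (weilHeight_nonneg (α : K)) hm hle
    have := log_le_log (cosh_pos _) this
    rwa [log_mul (exp_pos _).ne' (cosh_pos _).ne', log_exp] at this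
  rw [← exp_logDenoms]
  refine (pow_lt_pow_left₀ h1 (by norm_num) finrank_pos.ne').trans_eq ?_
  rw [← exp_nat_mul, mul_div_cancel₀ _ hd.ne']

theorem latticeTerm_le_of_isBalanced (t : ℕ) (R : ℝ) {α : Kˣ} (h : IsBalanced α) :
    latticeTerm t R α ≤ ((denomIndex K α : ℝ) * denomIndex K α⁻¹) ^ (-(t / 4 : ℝ)) *
      exp (-(t * finrank ℚ K / 2 * log (cosh (3 * weilHeight K (α : K) / 2)))) *
        vol (ball K t R) := by
  refine (latticeTerm_le_exp t R α).trans (mul_le_mul_of_nonneg_right ?_ (vol_nonneg _))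
  have hd : (0 : ℝ) < finrank ℚ K := by exact_mod_cast finrank_pos
  rw [← exp_logDenoms, ← exp_mul, ← exp_nat_mul, ← exp_add]
  apply exp_le_exp.2
  unfold IsBalanced at h
  have h2 : finrank ℚ K * log (cosh (3 * weilHeight K (α : K) / 2)) ≤ logDenoms α / 2 +
      finrank ℚ K * log (cosh (2 * weilHeight K (α : K) - logDenoms α / finrank ℚ K)) := by
    have := mul_le_mul_of_nonneg_left h hd.le
    have e : finrank ℚ K * (logDenoms α / finrank ℚ K / 2) = logDenoms α / 2 := by field_simp
    rw [mul_add, e] at this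
    exact this
  have ht : (0 : ℝ) ≤ t := Nat.cast_nonneg t
  nlinarith [mul_le_mul_of_nonneg_left h2 ht]

theorem le_pow_mul_pow_mul {X u v c : ℝ} (hu : 0 ≤ u) (hv : 0 ≤ v) (hc : 0 ≤ c) (k l : ℕ)
    (h1 : X ≤ u ^ (k + l) * c) (h2 : X ≤ v ^ (k + l) * c) : X ≤ u ^ k * v ^ l * c := by
  rcases le_total u v with h | h
  · refine h1.trans ?_
    rw [pow_add]
    gcongr
  · refine h2.trans ?_
    rw [pow_add]
    gcongr

/-- Four factors keep a = 3/4, for summation over a lattice. The other t - 4 use the geometric mean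
with exponents 1/4 and 3/4 of the bounds D(α)⁻¹ (a = 1) and cosh(2h)^(-d/2) (from a = 1/2); 3/4 · 2h
= 3h/2 explains the final cosh. The bounds are hypotheses on X so that the lemma also serves
inverted terms. -/
theorem latticeTerm_le_of_le_weilHeight {h₀ : ℝ} (hh : 0 ≤ h₀) {t : ℕ} (ht : 4 ≤ t) (R : ℝ)
    {α : Kˣ} (hα : h₀ ≤ weilHeight K (α : K)) {X : ℝ}
    (hX : ∀ a : ℝ, 0 ≤ a → a ≤ 1 →
      X ≤ ((denomIndex K α * meanNorm a (α : K))⁻¹) ^ t * vol (ball K t R)) :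
    X ≤ (denomIndex K α : ℝ) ^ (-(t / 4 : ℝ) - 3) * (meanNorm (3 / 4) (α : K) ^ 4)⁻¹ *
      exp (-(1 / 2 * log (cosh (3 * h₀ / 2)) * finrank ℚ K * (t - 4))) * vol (ball K t R) := by
  obtain ⟨l, rfl⟩ := Nat.exists_eq_add_of_le ht
  have hd : (0 : ℝ) < finrank ℚ K := by exact_mod_cast finrank_pos
  have hD : (0 : ℝ) < denomIndex K α := by exact_mod_cast denomIndex_pos α
  have hpos := denomIndex_mul_meanNorm_pos (a := 1 / 2) (by norm_num) (by norm_num) α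
  have hpos' := denomIndex_mul_meanNorm_pos (a := 3 / 4) (by norm_num) (by norm_num) α
  set L := log (cosh (3 * h₀ / 2)) with hL
  set p := -log (denomIndex K α) with hp
  set q := -(finrank ℚ K / 2 * log (cosh (2 * weilHeight K (α : K)))) with hq
  have h1 : X ≤ exp p ^ (4 + l) * vol (ball K (4 + l) R) := by
    have := hX 1 zero_le_one le_rfl
    rw [hp, exp_neg, exp_log hD]
    simpa [meanNorm] using this
  have h2 : X ≤ exp q ^ (4 + l) * vol (ball K (4 + l) R) := by
    refine (hX (1 / 2) (by norm_num) (by norm_num)).trans ?_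
    refine mul_le_mul_of_nonneg_right (pow_le_pow_left₀ (inv_pos.2 hpos).le ?_ _) (vol_nonneg _)
    rw [← exp_log hpos, ← exp_neg]
    apply exp_le_exp.2
    have h3 := le_log_denomIndex_mul_meanNorm α
    have hm : 0 ≤ logDenoms α / finrank ℚ K := div_nonneg (logDenoms_nonneg α) hd.le
    have h4 := cosh_add_le_exp_mul_cosh (2 * weilHeight K (α : K) - logDenoms α / finrank ℚ K) hm
    rw [sub_add_cancel] at h4
    have h5 := log_le_log (cosh_pos _) h4
    rw [log_mul (exp_pos _).ne' (cosh_pos _).ne', log_exp] at h5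
    have h6 := mul_le_mul_of_nonneg_left h5 hd.le
    rw [mul_add, mul_div_cancel₀ _ hd.ne'] at h6
    linarith
  have h3 : X ≤ exp (1 / 4 * p + 3 / 4 * q) ^ (4 + l) * vol (ball K (4 + l) R) := by
    rcases le_total p q with h | h
    · refine h1.trans (mul_le_mul_of_nonneg_right ?_ (vol_nonneg _))
      gcongr
      linarith
    · refine h2.trans (mul_le_mul_of_nonneg_right ?_ (vol_nonneg _))
      gcongr
      linarith
  have h4 : 3 / 4 * q ≤ -(1 / 2 * L * finrank ℚ K) := by
    have h5 := log_cosh_mul_le (s := 3 / 4) (by norm_num) (by norm_num) (2 * weilHeight K (α : K))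
    have h6 : L ≤ log (cosh (3 / 4 * (2 * weilHeight K (α : K)))) :=
      log_cosh_mono (by positivity) (by linarith)
    have h7 := mul_le_mul_of_nonneg_left (h6.trans h5) hd.le
    rw [hq]
    linarith
  have h5 := le_pow_mul_pow_mul (inv_pos.2 hpos').le (exp_pos _).le (vol_nonneg _) 4 l
    (hX (3 / 4) (by norm_num) (by norm_num)) h3
  refine h5.trans (mul_le_mul_of_nonneg_right ?_ (vol_nonneg _))
  have e : (denomIndex K α : ℝ) ^ (-(((4 + l : ℕ) : ℝ) / 4) - 3) =
      ((denomIndex K α : ℝ) ^ 4)⁻¹ * exp (1 / 4 * p) ^ l := by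
    rw [← rpow_natCast, ← rpow_neg hD.le, ← exp_nat_mul, hp,
      show (l : ℝ) * (1 / 4 * -log (denomIndex K α)) = log (denomIndex K α) * (-(l / 4)) by ring,
      ← rpow_def_of_pos hD, ← rpow_add hD]
    congr 1
    push_cast
    ring
  rw [e, inv_pow, mul_pow, mul_inv, exp_add, mul_pow]
  have h6 : exp (3 / 4 * q) ^ l ≤
      exp (-(1 / 2 * L * finrank ℚ K * (((4 + l : ℕ) : ℝ) - 4))) := by
    rw [← exp_nat_mul]
    apply exp_le_exp.2
    push_cast
    nlinarith [mul_le_mul_of_nonneg_left h4 (Nat.cast_nonneg l : (0 : ℝ) ≤ l)]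
  calc _ = (((denomIndex K α : ℝ) ^ 4)⁻¹ * exp (1 / 4 * p) ^ l * (meanNorm (3 / 4) (α : K) ^ 4)⁻¹) *
        exp (3 / 4 * q) ^ l := by ring
    _ ≤ _ := mul_le_mul_of_nonneg_left h6 (by
        have := meanNorm_pos (a := 3 / 4) (by norm_num) (by norm_num) α
        positivity)

end Terms

/-! ### Summation over height shells. -/

section Shells

open NumberField NumberField.InfinitePlace Module Ideal Real

variable {K : Type*} [Field K] [NumberField K]

theorem le_rankThreshold (cS h₀ : ℝ) : 4 ≤ rankThreshold K cS h₀ := le_max_left _ _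

/-- For k = 0 this is the definition of t₀. Scaling heights by s ≥ 1 multiplies the left side by at
most s (Bernoulli) and the right side by at least s (convexity). -/
theorem rank_mul_log_le {cS h₀ : ℝ} (hc : 0 < cS) (hh : 0 < h₀) (k : ℕ) :
    Units.rank K * log (1 + 2 * shellHeight h₀ (k + 1) / cS) ≤
      rankThreshold K cS h₀ * finrank ℚ K / 2 * log (cosh (3 * shellHeight h₀ k / 2)) := by
  have hd : (0 : ℝ) < finrank ℚ K := by exact_mod_cast finrank_pos
  have hL : 0 < log (cosh (3 * h₀ / 2)) := log_cosh_pos (by positivity)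
  have hhk := shellHeight_pos hh k
  set s := shellHeight h₀ k / h₀ with hs
  have hs1 : 1 ≤ s := by
    rw [hs, one_le_div hh]
    simpa [shellHeight_zero] using monotone_shellHeight hh (Nat.zero_le k)
  set y := (12 * h₀ + 1) / (6 * cS) with hy
  have hy0 : 0 < y := by positivity
  have e1 : 2 * shellHeight h₀ (k + 1) / cS = s * y := by
    rw [shellHeight_succ, hs, hy]; field_simp; ring
  have h1 : log (1 + s * y) ≤ s * log (1 + y) := by
    rw [← log_rpow (by positivity)]
    exact log_le_log (by positivity) (one_add_mul_self_le_rpow_one_add (by linarith) hs1)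
  have h2 : Units.rank K * log (1 + y) ≤
      rankThreshold K cS h₀ * finrank ℚ K / 2 * log (cosh (3 * h₀ / 2)) := by
    have h3 : 2 * (Units.rank K : ℝ) / finrank ℚ K * (log (1 + y) / log (cosh (3 * h₀ / 2))) ≤
        rankThreshold K cS h₀ := le_max_right _ _
    have h4 : Units.rank K * log (1 + y) = 2 * (Units.rank K : ℝ) / finrank ℚ K *
        (log (1 + y) / log (cosh (3 * h₀ / 2))) * finrank ℚ K / 2 * log (cosh (3 * h₀ / 2)) := by
      field_simp
    rw [h4]
    gcongr
  have h5 := le_log_cosh_mul hs1 (3 * h₀ / 2)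
  have e2 : s * (3 * h₀ / 2) = 3 * shellHeight h₀ k / 2 := by rw [hs]; field_simp
  rw [e2] at h5
  have ht : 0 ≤ rankThreshold K cS h₀ := by linarith [le_rankThreshold (K := K) cS h₀]
  rw [e1]
  calc _ ≤ Units.rank K * (s * log (1 + y)) := by gcongr
    _ = s * (Units.rank K * log (1 + y)) := by ring
    _ ≤ s * (rankThreshold K cS h₀ * finrank ℚ K / 2 * log (cosh (3 * h₀ / 2))) := by gcongr
    _ = rankThreshold K cS h₀ * finrank ℚ K / 2 * (s * log (cosh (3 * h₀ / 2))) := by ring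
    _ ≤ _ := by gcongr

theorem exists_shell {h₀ h : ℝ} (hh : 0 < h₀) (hlt : h₀ < h) :
    ∃ k, shellHeight h₀ k < h ∧ h ≤ shellHeight h₀ (k + 1) := by
  classical
  have hex : ∃ n, h ≤ shellHeight h₀ n :=
    ((tendsto_shellHeight hh).eventually_ge_atTop h).exists
  rcases hn : Nat.find hex with _ | k
  · have := Nat.find_spec hex
    rw [hn, shellHeight_zero] at this
    linarith
  · refine ⟨k, ?_, hn ▸ Nat.find_spec hex⟩
    by_contra hle
    have := Nat.find_min' hex (not_lt.1 hle)
    omega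

/-- The constant of the geometric series over the shells. -/
noncomputable def shellConstant (r : ℕ) (q : ℝ) : ℝ := if r = 0 then 1 else 1 + 1 / (1 - q)

theorem shell_sum_le {S : Finset (𝓞 K)ˣ} {cS : ℝ} (hS : IsUnitHeightBound K S cS) {h₀ : ℝ}
    (hh : 0 < h₀) {t : ℝ} (ht : rankThreshold K cS h₀ < t) (F : Finset Kˣ)
    (hF : ∀ α ∈ F, h₀ < weilHeight K (α : K))
    (hden : ∀ α ∈ F, ∀ β ∈ F, denIdeal (α : K) = denIdeal (β : K) ∧
      denIdeal ((α⁻¹ : Kˣ) : K) = denIdeal ((β⁻¹ : Kˣ) : K)) {δ : ℝ}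
    (hδ : δ = finrank ℚ K * (t - rankThreshold K cS h₀)) :
    ∑ α ∈ F, exp (-(t * finrank ℚ K / 2 * log (cosh (3 * weilHeight K (α : K) / 2)))) ≤
      S.card * exp (-(1 / 2 * log (cosh (3 * h₀ / 2)) * δ)) *
        shellConstant (Units.rank K) (exp (-(5 * δ / 192))) := by
  classical
  have hd : (0 : ℝ) < finrank ℚ K := by exact_mod_cast finrank_pos
  have hc := hS.pos
  have ht4 := le_rankThreshold (K := K) cS h₀
  have hδ0 : 0 < δ := by rw [hδ]; exact mul_pos hd (by linarith)
  set L := log (cosh (3 * h₀ / 2)) with hL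
  have hL0 : 0 < L := log_cosh_pos (by positivity)
  set t₀ := rankThreshold K cS h₀
  choose! k hk1 hk2 using fun α (hα : α ∈ F) => exists_shell hh (hF α hα)
  rw [shellConstant]
  split_ifs with hr
  · have hcard : (F.card : ℝ) ≤ S.card := by
      -- In rank 0 the count does not depend on the height bound, so any bound will do; the sum of
      -- all heights is one.
      have := card_le_of_denIdeal_eq hS
        (Finset.sum_nonneg fun α (_ : α ∈ F) => weilHeight_nonneg (α : K)) F
        (fun α hα => Finset.single_le_sum (f := fun α : Kˣ => weilHeight K (α : K))
          (fun α _ => weilHeight_nonneg (α : K)) hα) hden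
      simpa [hr] using this
    calc _ ≤ ∑ α ∈ F, exp (-(1 / 2 * L * δ)) := by
          refine Finset.sum_le_sum fun α hα => exp_le_exp.2 (neg_le_neg ?_)
          have h1 : L ≤ log (cosh (3 * weilHeight K (α : K) / 2)) :=
            log_cosh_mono (by positivity) (by linarith [hF α hα])
          have h2 : δ ≤ t * finrank ℚ K := by rw [hδ]; nlinarith
          calc 1 / 2 * L * δ ≤ 1 / 2 * L * (t * finrank ℚ K) := by gcongr
            _ = t * finrank ℚ K / 2 * L := by ring
            _ ≤ _ := by
              have : 0 ≤ t := by linarith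
              gcongr
      _ = F.card * exp (-(1 / 2 * L * δ)) := by rw [Finset.sum_const, nsmul_eq_mul]
      _ ≤ _ := by rw [mul_one]; gcongr
  set q := exp (-(5 * δ / 192)) with hq
  have hq0 : 0 < q := exp_pos _
  have hq1 : q < 1 := by
    rw [hq, exp_lt_one_iff]
    linarith
  set n := F.sup k + 1 with hn
  have hmaps : ∀ α ∈ F, k α ∈ Finset.range n := fun α hα => by
    rw [Finset.mem_range, hn, Nat.lt_succ_iff]
    exact Finset.le_sup hα
  rw [← Finset.sum_fiberwise_of_maps_to hmaps]
  have hfib : ∀ j, ∑ α ∈ F with k α = j,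
      exp (-(t * finrank ℚ K / 2 * log (cosh (3 * weilHeight K (α : K) / 2)))) ≤
      S.card * exp (-(δ / 2 * log (cosh (3 * shellHeight h₀ j / 2)))) := by
    intro j
    set Lj := log (cosh (3 * shellHeight h₀ j / 2)) with hLj
    have hpos := shellHeight_pos hh j
    have hpos' := shellHeight_pos hh (j + 1)
    have hcard : ((F.filter fun α => k α = j).card : ℝ) ≤
        S.card * (1 + 2 * shellHeight h₀ (j + 1) / cS) ^ Units.rank K := by
      refine card_le_of_denIdeal_eq hS hpos'.le _ (fun α hα => ?_) fun α hα β hβ => ?_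
      · rw [Finset.mem_filter] at hα
        rw [← hα.2]
        exact hk2 α hα.1
      · exact hden α (Finset.mem_filter.1 hα).1 β (Finset.mem_filter.1 hβ).1
    have hcount : (1 + 2 * shellHeight h₀ (j + 1) / cS) ^ Units.rank K ≤
        exp (t₀ * finrank ℚ K / 2 * Lj) := by
      rw [← exp_log (by positivity : 0 < (1 + 2 * shellHeight h₀ (j + 1) / cS)), ← exp_nat_mul]
      exact exp_le_exp.2 (rank_mul_log_le hc hh j)
    calc _ ≤ ∑ α ∈ F with k α = j, exp (-(t * finrank ℚ K / 2 * Lj)) := by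
          refine Finset.sum_le_sum fun α hα => exp_le_exp.2 (neg_le_neg ?_)
          rw [Finset.mem_filter] at hα
          have : Lj ≤ log (cosh (3 * weilHeight K (α : K) / 2)) := by
            refine log_cosh_mono (by positivity) ?_
            have := hk1 α hα.1
            rw [hα.2] at this
            linarith
          have : 0 ≤ t := by linarith
          gcongr
      _ = (F.filter fun α => k α = j).card * exp (-(t * finrank ℚ K / 2 * Lj)) := by
          rw [Finset.sum_const, nsmul_eq_mul]
      _ ≤ S.card * exp (t₀ * finrank ℚ K / 2 * Lj) * exp (-(t * finrank ℚ K / 2 * Lj)) := by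
          gcongr
          exact hcard.trans (by gcongr)
      _ = _ := by
          rw [mul_assoc, ← exp_add, hδ]
          congr 2
          ring
  refine (Finset.sum_le_sum fun j _ => hfib j).trans ?_
  -- Shell 0 is split off because the gain of 5/96 starts only at shell 1: the total is 1 plus a
  -- full geometric series.
  rw [← Finset.mul_sum, mul_assoc, hn, Finset.sum_range_succ', shellHeight_zero, ← hL]
  refine mul_le_mul_of_nonneg_left ?_ (Nat.cast_nonneg _)
  have hgeom : ∀ j, exp (-(δ / 2 * log (cosh (3 * shellHeight h₀ (j + 1) / 2)))) ≤
      exp (-(1 / 2 * L * δ)) * q ^ j := by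
    intro j
    rw [hq, ← exp_nat_mul, ← exp_add]
    apply exp_le_exp.2
    have := mul_le_mul_of_nonneg_left (log_cosh_shellHeight_ge hh j) hδ0.le
    linarith
  have hgs : ∑ j ∈ Finset.range (F.sup k), q ^ j ≤ 1 / (1 - q) := by
    rw [one_div, ← tsum_geometric_of_lt_one hq0.le hq1]
    exact (summable_geometric_of_lt_one hq0.le hq1).sum_le_tsum _ fun _ _ => by positivity
  calc _ ≤ ∑ j ∈ Finset.range (F.sup k), exp (-(1 / 2 * L * δ)) * q ^ j + exp (-(1 / 2 * L * δ)) :=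
        add_le_add (Finset.sum_le_sum fun j _ => hgeom j) (exp_le_exp.2 (by linarith))
    _ = exp (-(1 / 2 * L * δ)) * (1 + ∑ j ∈ Finset.range (F.sup k), q ^ j) := by
        rw [← Finset.mul_sum]; ring
    _ ≤ _ := by gcongr

end Shells

/-! ### Assembling the balanced and unbalanced contributions. -/

section Totals

open NumberField NumberField.InfinitePlace Module Ideal Real

variable {K : Type*} [Field K] [NumberField K]

theorem absNorm_mul_rpow_denIdeal (α : Kˣ) (s : ℝ) :
    ((absNorm (denIdeal (α : K)) : ℝ) * absNorm (denIdeal ((α⁻¹ : Kˣ) : K))) ^ s =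
      ((denomIndex K α : ℝ) * denomIndex K α⁻¹) ^ s := by
  rw [denomIndex_eq_absNorm, denomIndex_eq_absNorm]

/-- The contribution of the balanced elements. -/
theorem sum_balanced_le {S : Finset (𝓞 K)ˣ} {cS : ℝ} (hS : IsUnitHeightBound K S cS) {h₀ : ℝ}
    (hh : 0 < h₀) {t : ℕ} (ht : rankThreshold K cS h₀ < t) (R : ℝ) (F : Finset Kˣ)
    (hF : ∀ α ∈ F, h₀ < weilHeight K (α : K)) (hbal : ∀ α ∈ F, IsBalanced α) {δ : ℝ}
    (hδ : δ = finrank ℚ K * (t - rankThreshold K cS h₀)) :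
    ∑ α ∈ F, latticeTerm t R α ≤
      shellConstant (Units.rank K) (exp (-(5 * δ / 192))) * S.card *
        (realDedekindZeta K (t / 4) ^ 2 / realDedekindZeta K (t / 2)) *
          exp (-(1 / 2 * log (cosh (3 * h₀ / 2)) * δ)) * vol (ball K t R) := by
  classical
  have ht4 := le_rankThreshold (K := K) cS h₀
  let g : Kˣ → Ideal (𝓞 K) × Ideal (𝓞 K) := fun α =>
    (denIdeal (α : K), denIdeal ((α⁻¹ : Kˣ) : K))
  have hV := vol_nonneg (ball K t R)
  set M := S.card * exp (-(1 / 2 * log (cosh (3 * h₀ / 2)) * δ)) *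
        shellConstant (Units.rank K) (exp (-(5 * δ / 192))) with hM
  have hM0 : 0 ≤ M := by
    have := shell_sum_le hS hh ht ∅ (by simp) (by simp) hδ
    rwa [Finset.sum_empty] at this
  rw [← Finset.sum_fiberwise_of_maps_to fun α hα => Finset.mem_image_of_mem g hα]
  have hfib : ∀ p ∈ F.image g, ∑ α ∈ F with g α = p, latticeTerm t R α ≤
      ((absNorm p.1 : ℝ) * absNorm p.2) ^ (-(t / 4 : ℝ)) * (M * vol (ball K t R)) := by
    intro p _
    have h1 := shell_sum_le hS hh ht (F.filter fun α => g α = p)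
      (fun α hα => hF α (Finset.mem_filter.1 hα).1) (fun α hα β hβ => by
        have := (Finset.mem_filter.1 hα).2.trans (Finset.mem_filter.1 hβ).2.symm
        exact ⟨congrArg Prod.fst this, congrArg Prod.snd this⟩) hδ
    calc _ ≤ ∑ α ∈ F with g α = p, ((absNorm p.1 : ℝ) * absNorm p.2) ^ (-(t / 4 : ℝ)) *
          (exp (-(t * finrank ℚ K / 2 * log (cosh (3 * weilHeight K (α : K) / 2)))) *
            vol (ball K t R)) := by
          refine Finset.sum_le_sum fun α hα => ?_
          rw [Finset.mem_filter] at hα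
          have := latticeTerm_le_of_isBalanced t R (hbal α hα.1)
          rw [← hα.2, absNorm_mul_rpow_denIdeal, ← mul_assoc]
          exact this
      _ = ((absNorm p.1 : ℝ) * absNorm p.2) ^ (-(t / 4 : ℝ)) * ((∑ α ∈ F with g α = p,
          exp (-(t * finrank ℚ K / 2 * log (cosh (3 * weilHeight K (α : K) / 2))))) *
            vol (ball K t R)) := by
          rw [← Finset.mul_sum, Finset.sum_mul]
      _ ≤ _ := by gcongr
  refine (Finset.sum_le_sum hfib).trans ?_
  rw [← Finset.sum_mul]
  have hz := sum_coprime_le K (s := t / 4) (by linarith) (F.image g) (by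
    intro p hp
    obtain ⟨α, _, rfl⟩ := Finset.mem_image.1 hp
    exact ⟨isCoprime_denIdeal α, denIdeal_ne_bot α, denIdeal_ne_bot α⁻¹⟩)
  rw [show 2 * ((t : ℝ) / 4) = t / 2 by ring] at hz
  calc _ ≤ realDedekindZeta K (t / 4) ^ 2 / realDedekindZeta K (t / 2) *
        (M * vol (ball K t R)) := by gcongr
    _ = _ := by rw [hM]; ring

/-- The contribution of the remaining elements with large denominator. -/
theorem sum_unbalanced_le {cS h₀ : ℝ} (hh : 0 < h₀) {t : ℕ} (ht : rankThreshold K cS h₀ < t)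
    (R : ℝ) (F : Finset Kˣ) (hF : ∀ α ∈ F, h₀ < weilHeight K (α : K))
    (hbal : ∀ α ∈ F, ¬ IsBalanced α) (hle : ∀ α ∈ F, denomIndex K α⁻¹ ≤ denomIndex K α)
    (X : Kˣ → ℝ) (hX : ∀ α ∈ F, ∀ a : ℝ, 0 ≤ a → a ≤ 1 →
      X α ≤ ((denomIndex K α * meanNorm a (α : K))⁻¹) ^ t * vol (ball K t R)) {δ : ℝ}
    (hδ : δ = finrank ℚ K * (t - rankThreshold K cS h₀)) :
    ∑ α ∈ F, X α ≤ (if Units.rank K = 0 then 2 else 1) *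
        (realDedekindZeta K (t / 4) ^ 2 / realDedekindZeta K (t / 2)) *
          exp (-(1 / 2 * log (cosh (3 * h₀ / 2)) * δ)) * vol (ball K t R) := by
  classical
  have hd : (0 : ℝ) < finrank ℚ K := by exact_mod_cast finrank_pos
  have ht4 := le_rankThreshold (K := K) cS h₀
  have ht4' : 4 ≤ t := by
    have : (4 : ℝ) ≤ t := by linarith
    exact_mod_cast this
  have hV := vol_nonneg (ball K t R)
  have hL0 : 0 ≤ log (cosh (3 * h₀ / 2)) := log_cosh_nonneg _
  set E := exp (-(1 / 2 * log (cosh (3 * h₀ / 2)) * δ)) with hE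
  have hEle : exp (-(1 / 2 * log (cosh (3 * h₀ / 2)) * finrank ℚ K * (t - 4))) ≤ E := by
    rw [hE]
    apply exp_le_exp.2
    have : δ ≤ finrank ℚ K * ((t : ℝ) - 4) := by rw [hδ]; gcongr
    have := mul_le_mul_of_nonneg_left this hL0
    linarith
  set β : ℝ := if Units.rank K = 0 then 2 else 1 with hβ
  have hβ0 : 0 ≤ β := by rw [hβ]; split_ifs <;> norm_num
  let g : Kˣ → Ideal (𝓞 K) := fun α => denIdeal (α : K)
  rw [← Finset.sum_fiberwise_of_maps_to fun α hα => Finset.mem_image_of_mem g hα]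
  have hfib : ∀ b ∈ F.image g, ∑ α ∈ F with g α = b, X α ≤
      (absNorm b : ℝ) ^ (-(t / 4 : ℝ)) * (β * E * vol (ball K t R)) := by
    intro b hb
    obtain ⟨α₀, hα₀, rfl⟩ := Finset.mem_image.1 hb
    have hN : (0 : ℝ) < absNorm (g α₀) := by
      exact_mod_cast Nat.pos_of_ne_zero (absNorm_eq_zero_iff.not.2 (denIdeal_ne_bot α₀))
    have hlarge : (19 / 5 : ℝ) ^ finrank ℚ K ≤ absNorm (g α₀) ^ 2 := by
      refine (lt_of_not_isBalanced (hbal α₀ hα₀)).le.trans ?_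
      have h1 : (denomIndex K α₀⁻¹ : ℝ) ≤ denomIndex K α₀ := by exact_mod_cast hle α₀ hα₀
      have e : (absNorm (g α₀) : ℝ) = denomIndex K α₀ := by rw [denomIndex_eq_absNorm]
      rw [e, pow_two]
      gcongr
    have hs := sum_inv_meanNorm_pow_le (denIdeal_ne_bot α₀) (F.filter fun α => g α = g α₀)
      (fun α hα => (Finset.mem_filter.1 hα).2) hlarge
    calc _ ≤ ∑ α ∈ F with g α = g α₀, (absNorm (g α₀) : ℝ) ^ (-(t / 4 : ℝ) - 3) *
          (meanNorm (3 / 4) (α : K) ^ 4)⁻¹ * E * vol (ball K t R) := by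
          refine Finset.sum_le_sum fun α hα => ?_
          rw [Finset.mem_filter] at hα
          refine (latticeTerm_le_of_le_weilHeight hh.le ht4' R (hF α hα.1).le (hX α hα.1)).trans ?_
          have e : (absNorm (g α₀) : ℝ) = denomIndex K α := by rw [denomIndex_eq_absNorm, ← hα.2]
          have := meanNorm_pos (a := 3 / 4) (by norm_num) (by norm_num) α
          rw [e]
          gcongr
      _ = (absNorm (g α₀) : ℝ) ^ (-(t / 4 : ℝ) - 3) * (∑ α ∈ F with g α = g α₀,
          (meanNorm (3 / 4) (α : K) ^ 4)⁻¹) * E * vol (ball K t R) := by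
          rw [Finset.mul_sum, Finset.sum_mul, Finset.sum_mul]
      _ ≤ (absNorm (g α₀) : ℝ) ^ (-(t / 4 : ℝ) - 3) * (β * (absNorm (g α₀) : ℝ) ^ 3) * E *
          vol (ball K t R) := by gcongr
      _ = _ := by
          have : (absNorm (g α₀) : ℝ) ^ (-(t / 4 : ℝ)) =
              (absNorm (g α₀) : ℝ) ^ (-(t / 4 : ℝ) - 3) * (absNorm (g α₀) : ℝ) ^ 3 := by
            rw [← rpow_natCast, ← rpow_add hN]
            congr 1
            push_cast
            ring
          rw [this]
          ring
  refine (Finset.sum_le_sum hfib).trans ?_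
  rw [← Finset.sum_mul]
  -- Pairing b with the unit ideal makes a coprime pair, so the same zeta quotient appears as in the
  -- balanced case.
  have hz := sum_coprime_le K (s := t / 4) (by linarith)
    ((F.image g).image fun b => ((⊤ : Ideal (𝓞 K)), b)) (by
    intro p hp
    obtain ⟨b, hb, rfl⟩ := Finset.mem_image.1 hp
    obtain ⟨α, _, rfl⟩ := Finset.mem_image.1 hb
    exact ⟨by rw [isCoprime_iff_sup_eq, top_sup_eq], top_ne_bot, denIdeal_ne_bot α⟩)
  rw [show 2 * ((t : ℝ) / 4) = t / 2 by ring,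
    Finset.sum_image fun a _ b _ h => (Prod.mk.inj h).2] at hz
  simp only [absNorm_top, Nat.cast_one, one_mul] at hz
  calc _ ≤ realDedekindZeta K (t / 4) ^ 2 / realDedekindZeta K (t / 2) *
        (β * E * vol (ball K t R)) := by gcongr
    _ = _ := by ring

/-- The unbalanced estimate carries no factor #S; this lets #S absorb its two halves. -/
theorem two_le_card {S : Finset (𝓞 K)ˣ} {cS : ℝ} (hS : IsUnitHeightBound K S cS) :
    (2 : ℝ) ≤ S.card := by
  have h1 : (1 : (𝓞 K)ˣ) ∈ S := hS.torsion_subset _ (one_mem _)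
  have h2 : (-1 : (𝓞 K)ˣ) ∈ S := hS.torsion_subset _ (by
    rw [Units.torsion, CommGroup.mem_torsion, isOfFinOrder_iff_pow_eq_one]
    exact ⟨2, by norm_num, by simp⟩)
  have hne : (1 : (𝓞 K)ˣ) ≠ -1 := by
    intro h
    have := congrArg (fun u : (𝓞 K)ˣ => (u : 𝓞 K)) h
    simp only [Units.val_one, Units.val_neg] at this
    exact (self_ne_neg.2 one_ne_zero) this
  have := Finset.one_lt_card.2 ⟨1, h1, -1, h2, hne⟩
  exact_mod_cast this

theorem sum_latticeTerm_le {S : Finset (𝓞 K)ˣ} {cS : ℝ} (hS : IsUnitHeightBound K S cS) {h₀ : ℝ}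
    (hh : 0 < h₀) {t : ℕ} (ht : rankThreshold K cS h₀ < t) (R : ℝ) (F : Finset Kˣ)
    (hF : ∀ α ∈ F, h₀ < weilHeight K (α : K)) {δ : ℝ}
    (hδ : δ = finrank ℚ K * (t - rankThreshold K cS h₀)) :
    ∑ α ∈ F, latticeTerm t R α ≤ (1 + 2 / (1 - exp (-(5 * δ / 192)))) * S.card *
        (realDedekindZeta K (t / 4) ^ 2 / realDedekindZeta K (t / 2)) *
          exp (-(1 / 2 * log (cosh (3 * h₀ / 2)) * δ)) * vol (ball K t R) := by
  classical
  have hd : (0 : ℝ) < finrank ℚ K := by exact_mod_cast finrank_pos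
  have ht4 := le_rankThreshold (K := K) cS h₀
  have hδ0 : 0 < δ := by rw [hδ]; exact mul_pos hd (by linarith)
  set Q := (realDedekindZeta K (t / 4) ^ 2 / realDedekindZeta K (t / 2)) *
          exp (-(1 / 2 * log (cosh (3 * h₀ / 2)) * δ)) * vol (ball K t R) with hQ
  have hQ0 : 0 ≤ Q := by
    have h1 := realDedekindZeta_pos K (s := t / 4) (by linarith)
    have h2 := realDedekindZeta_pos K (s := t / 2) (by linarith)
    have := vol_nonneg (ball K t R)
    positivity
  have h1 := sum_balanced_le hS hh ht R (F.filter IsBalanced)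
    (fun α hα => hF α (Finset.mem_filter.1 hα).1) (fun α hα => (Finset.mem_filter.1 hα).2) hδ
  let F' := F.filter fun α => ¬ IsBalanced α
  have h2 := sum_unbalanced_le (cS := cS) hh ht R
    (F'.filter fun α => denomIndex K α⁻¹ ≤ denomIndex K α)
    (fun α hα => hF α (Finset.mem_filter.1 (Finset.mem_filter.1 hα).1).1)
    (fun α hα => (Finset.mem_filter.1 (Finset.mem_filter.1 hα).1).2)
    (fun α hα => (Finset.mem_filter.1 hα).2) (latticeTerm t R)
    (fun α _ a h0 h1 => latticeTerm_le h0 h1 α) hδ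
  -- The half with D(α) < D(α⁻¹) is treated through the inverses.
  have h3 := sum_unbalanced_le (cS := cS) hh ht R
    ((F'.filter fun α => ¬ denomIndex K α⁻¹ ≤ denomIndex K α).image fun α => α⁻¹)
    (fun α hα => by
      obtain ⟨β, hβ, rfl⟩ := Finset.mem_image.1 hα
      rw [weilHeight_inv]
      exact hF β (Finset.mem_filter.1 (Finset.mem_filter.1 hβ).1).1)
    (fun α hα => by
      obtain ⟨β, hβ, rfl⟩ := Finset.mem_image.1 hα
      rw [isBalanced_inv]
      exact (Finset.mem_filter.1 (Finset.mem_filter.1 hβ).1).2)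
    (fun α hα => by
      obtain ⟨β, hβ, rfl⟩ := Finset.mem_image.1 hα
      rw [inv_inv]
      exact (not_le.1 (Finset.mem_filter.1 hβ).2).le) (fun α => latticeTerm t R α⁻¹)
    (fun α _ a h0 h1 => by
      rw [← denomIndex_mul_meanNorm_inv h0 h1]
      exact latticeTerm_le (by linarith) (by linarith) α⁻¹) hδ
  rw [Finset.sum_image fun α _ β _ h => inv_injective h] at h3
  simp only [inv_inv] at h3
  have hsplit : ∑ α ∈ F, latticeTerm t R α = ∑ α ∈ F with IsBalanced α, latticeTerm t R α +
      (∑ α ∈ F' with denomIndex K α⁻¹ ≤ denomIndex K α, latticeTerm t R α +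
        ∑ α ∈ F' with ¬ denomIndex K α⁻¹ ≤ denomIndex K α, latticeTerm t R α) := by
    rw [Finset.sum_filter_add_sum_filter_not, Finset.sum_filter_add_sum_filter_not]
  rw [hsplit]
  set q := exp (-(5 * δ / 192)) with hq
  have hq0 : 0 < q := exp_pos _
  have hq1 : q < 1 := by
    rw [hq, exp_lt_one_iff]
    linarith
  have hinv : 1 ≤ 1 / (1 - q) := by
    rw [one_le_div (by linarith)]
    linarith
  -- The extra 2 in rank 0 is affordable because the shell constant is then 1; both cases reduce to
  -- 1 ≤ 1/(1 - q).
  have hconst : shellConstant (Units.rank K) q + (if Units.rank K = 0 then 2 else 1) ≤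
      1 + 2 / (1 - q) := by
    have e : 2 / (1 - q) = 2 * (1 / (1 - q)) := by ring
    rw [e, shellConstant]
    split_ifs <;> linarith
  set β : ℝ := if Units.rank K = 0 then 2 else 1 with hβ
  have hβ0 : 0 ≤ β := by rw [hβ]; split_ifs <;> norm_num
  have hcard := two_le_card hS
  have e1 : shellConstant (Units.rank K) q * S.card *
        (realDedekindZeta K (t / 4) ^ 2 / realDedekindZeta K (t / 2)) *
          exp (-(1 / 2 * log (cosh (3 * h₀ / 2)) * δ)) * vol (ball K t R) =
      shellConstant (Units.rank K) q * S.card * Q := by rw [hQ]; ring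
  have e2 : β * (realDedekindZeta K (t / 4) ^ 2 / realDedekindZeta K (t / 2)) *
          exp (-(1 / 2 * log (cosh (3 * h₀ / 2)) * δ)) * vol (ball K t R) = β * Q := by
    rw [hQ]; ring
  have e3 : (1 + 2 / (1 - q)) * S.card *
        (realDedekindZeta K (t / 4) ^ 2 / realDedekindZeta K (t / 2)) *
          exp (-(1 / 2 * log (cosh (3 * h₀ / 2)) * δ)) * vol (ball K t R) =
      (1 + 2 / (1 - q)) * (S.card * Q) := by rw [hQ]; ring
  rw [e1] at h1
  rw [e2] at h2 h3
  rw [e3]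
  have h4 : 2 * (β * Q) ≤ S.card * (β * Q) :=
    mul_le_mul_of_nonneg_right hcard (mul_nonneg hβ0 hQ0)
  calc _ ≤ shellConstant (Units.rank K) q * S.card * Q + 2 * (β * Q) := by linarith
    _ ≤ (shellConstant (Units.rank K) q + β) * (S.card * Q) := by linarith
    _ ≤ _ := mul_le_mul_of_nonneg_right hconst (mul_nonneg (Nat.cast_nonneg _) hQ0)

end Totals

end ModuleLattice


theorem mainTheorem7 (K : Type*) [Field K] [NumberField K]
    (S : Finset (𝓞 K)ˣ) (cS : ℝ) (hS : ModuleLattice.IsUnitHeightBound K S cS)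
    (h₀ : ℝ) (hcS : cS ≤ h₀) (hh₀ : h₀ ≤ 2)
    (d t₀ ε C : ℝ) (hd : d = (Module.finrank ℚ K : ℝ))
    (ht₀ : t₀ = ModuleLattice.rankThreshold K cS h₀)
    (t : ℕ) (ht : t₀ < (t : ℝ))
    (hε : ε = 1 / 2 * Real.log (Real.cosh (3 * h₀ / 2)))
    (hC : C = 1 + 2 / (1 - Real.exp (-(5 * d * ((t : ℝ) - t₀) / 192))))
    (R : ℝ) (hR : 0 < R) :
    Summable (fun α : {α : Kˣ // h₀ < ModuleLattice.weilHeight K (α : K)} =>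
      ((ModuleLattice.denomIndex K α.1 : ℝ) ^ t)⁻¹ *
        ModuleLattice.vol (ModuleLattice.ball K t R ∩
          ModuleLattice.scale ((α.1⁻¹ : Kˣ) : K) (ModuleLattice.ball K t R))) ∧
    ∑' α : {α : Kˣ // h₀ < ModuleLattice.weilHeight K (α : K)},
      ((ModuleLattice.denomIndex K α.1 : ℝ) ^ t)⁻¹ *
        ModuleLattice.vol (ModuleLattice.ball K t R ∩
          ModuleLattice.scale ((α.1⁻¹ : Kˣ) : K) (ModuleLattice.ball K t R))
      ≤ C * (S.card : ℝ) *
        (ModuleLattice.realDedekindZeta K ((t : ℝ) / 4) ^ 2 /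
          ModuleLattice.realDedekindZeta K ((t : ℝ) / 2)) *
        Real.exp (-(ε * d * ((t : ℝ) - t₀))) *
        ModuleLattice.vol (ModuleLattice.ball K t R) := by
  have hh : 0 < h₀ := hS.pos.trans_le hcS
  -- The terms are nonnegative, so a uniform bound on finite sums yields both convergence and the
  -- estimate.
  have key : ∀ F : Finset {α : Kˣ // h₀ < ModuleLattice.weilHeight K (α : K)},
      ∑ α ∈ F, ModuleLattice.latticeTerm t R α.1 ≤ C * (S.card : ℝ) *
        (ModuleLattice.realDedekindZeta K ((t : ℝ) / 4) ^ 2 /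
          ModuleLattice.realDedekindZeta K ((t : ℝ) / 2)) *
        Real.exp (-(ε * d * ((t : ℝ) - t₀))) *
        ModuleLattice.vol (ModuleLattice.ball K t R) := by
    intro F
    have h := ModuleLattice.sum_latticeTerm_le hS hh (ht₀ ▸ ht) R
      (F.map (Function.Embedding.subtype _)) (fun α hα => by
        obtain ⟨β, _, rfl⟩ := Finset.mem_map.1 hα
        exact β.2) (δ := d * (t - t₀)) (by rw [hd, ht₀])
    rw [Finset.sum_map, ← hε] at h
    rw [hC, mul_assoc 5 d, mul_assoc ε d]
    exact h
  have hnn : ∀ α : {α : Kˣ // h₀ < ModuleLattice.weilHeight K (α : K)},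
      0 ≤ ModuleLattice.latticeTerm t R α.1 := fun α => ModuleLattice.latticeTerm_nonneg t R α.1
  have hsum := summable_of_sum_le hnn key
  exact ⟨hsum, hsum.tsum_le_of_sum_le key⟩
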